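/- Let $(x_n)_{n\ge 1}$ be a sequence of positive real numbers for which there exists $c>0$ such that $x_{n+1}-x_n\ge c$ for all $n\ge 1$. For $N\ge 1$ let $$E^*_N=\bigl|\{(n_1,n_2,n_3,n_4)\in\{1,\dots,N\}^4:\ |x_{n_1}-x_{n_2}+x_{n_3}-x_{n_4}|<1\}\bigr|.$$ Assume that there exists $\delta>0$ such that $E^*_N=O(N^{5/2-\delta})$ as $N\to\infty$, where the implied constant may depend on the sequence and on $\delta$. Then $(x_n)_{n\ge1}$ is metric Poissonian, that is, for Lebesgue-almost every $\alpha\in\mathbb{R}$ one has, for every $s>0$, $$\lim_{N\to\infty}\frac1N\Bigl|\Bigl\{(n_1,n_2):\ 1\le n_1\ne n_2\le N,\ \|\alpha x_{n_1}-\alpha x_{n_2}\|\le \frac sN\Bigr\}\Bigr|=2s,$$ where $\|t\|$ denotes the distance from $t$ to the nearest integer. -/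

import Mathlib

open Filter MeasureTheory

/-- The distance `‖t‖` from a real number `t` to the nearest integer. -/
noncomputable def distNearestInt (t : ℝ) : ℝ := |t - (round t : ℝ)|

/-- The number of ordered pairs `(n₁, n₂)` with `1 ≤ n₁ ≠ n₂ ≤ N` and
`‖y n₁ - y n₂‖ ≤ s / N`. Sequences are indexed by the positive integers; the value at `0`
is never used. -/
noncomputable def pairCount (y : ℕ → ℝ) (s : ℝ) (N : ℕ) : ℕ :=
  ((Finset.Icc 1 N ×ˢ Finset.Icc 1 N).filter
    (fun p => p.1 ≠ p.2 ∧ distNearestInt (y p.1 - y p.2) ≤ s / (N : ℝ))).card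

/-- Poissonian pair correlation of the sequence `(y n)`, `n ≥ 1`. -/
def HasPoissonianPairCorrelation (y : ℕ → ℝ) : Prop :=
  ∀ s : ℝ, 0 < s →
    Tendsto (fun N : ℕ => (1 / (N : ℝ)) * (pairCount y s N : ℝ)) atTop (nhds (2 * s))

/-- `(x n)` is metric Poissonian: `(α * x n)` has Poissonian pair correlation for Lebesgue-almost
every real `α`. -/
def MetricPoissonian (x : ℕ → ℝ) : Prop :=
  ∀ᵐ α : ℝ ∂volume, HasPoissonianPairCorrelation (fun n => α * x n)

/-- The approximate additive energy: the number of quadruples `(n₁, n₂, n₃, n₄)` in `{1, …, N}⁴`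
with `|x n₁ - x n₂ + x n₃ - x n₄| < γ`. -/
noncomputable def approxEnergy (x : ℕ → ℝ) (N : ℕ) (γ : ℝ) : ℕ :=
  ((Finset.Icc 1 N ×ˢ Finset.Icc 1 N ×ˢ Finset.Icc 1 N ×ˢ Finset.Icc 1 N).filter
    (fun q => |x q.1 - x q.2.1 + x q.2.2.1 - x q.2.2.2| < γ)).card

/-! Replace the indicator of `‖t‖ ≤ s/N` by a tent of height and half-width `s/N`. Its mean
contributes `s²(1 - 1/N)` to the tent correlation sum, and the rest is a cosine series with
frequencies `j z`, where `z` runs over the differences `x n - x m`, `m < n ≤ N`, and with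
coefficients at most `min ((s/N)², 1/j²)`. It suffices that the mean square of this series over `α`
is a negative power of `N`: it is then summable along `N = (k+1)^p` for large `p`, which gives
almost sure convergence there, and monotonicity fills the gaps. Averaging against a Gaussian makes
correlations of cosines decay rapidly and keeps the null sets of Lebesgue measure under control.

Split the frequencies into dyadic blocks `j ∈ [A, 2A)`. By `exists_integral_sq_cos_sum_le` a block
costs at most a constant times its largest coefficient squared times the number of solutions of `|a
z - b z'| < 1` with `a, b ∈ [A, 2A)`. This number is bounded in `dilateEnergy_le`, the heart of the
proof. Write `E` for the number of pairs of differences at distance less than 1; it is at most the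
additive energy. Cauchy–Schwarz over the values `⌊A z⌋` (`sq_dilateEnergy_le`) costs a factor `E`
and eliminates `z`: two solutions `a z ≈ b z'`, `c z ≈ d z''` give `c b z' ≈ a d z''` up to `O(A)`.
The divisor bound turns the products into free integers `u, v < 4A²`. Cutting the range of `u` into
`4A` blocks and taking differences reduces to `|u|, |v| ≤ C A`. A second Cauchy–Schwarz, now over
dilates by `u` and `v`, bounds what remains by a constant times `(N² + A √E)²`.

Altogether the count is at most `A^{1/2} E^{1/2} (N² + A E^{1/2})`, up to a small power of `N`. The
critical block is `A ≈ N`, where the coefficients squared are about `N⁻⁴`; there the term `A^{3/2}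
E` is admissible exactly when `E` is below `N^{5/2}`. -/

/-! ### The divisor bound -/

/-- The divisor function grows slower than any positive power. -/
theorem exists_card_divisors_le_rpow {ε : ℝ} (hε : 0 < ε) :
    ∃ C : ℝ, 0 < C ∧ ∀ n : ℕ, n ≠ 0 → (n.divisors.card : ℝ) ≤ C * (n : ℝ) ^ ε := by
  -- Primes `p ≥ P` have `p ^ ε ≥ 2`, so `a + 1 ≤ 2 ^ a` suffices for them. Each smaller prime costs
  -- at most a factor `M`, by Bernoulli's inequality.
  obtain ⟨P, hP⟩ := exists_nat_ge ((2 : ℝ) ^ (1 / ε))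
  set M : ℝ := 1 + 1 / (ε * Real.log 2) with hM
  have hl : 0 < ε * Real.log 2 := mul_pos hε (Real.log_pos one_lt_two)
  have hM1 : 1 ≤ M := by rw [hM]; have := one_div_pos.2 hl; linarith
  refine ⟨M ^ P, by positivity, fun n hn => ?_⟩
  have key : ∀ p ∈ n.primeFactors, ((n.factorization p + 1 : ℕ) : ℝ) ≤
      (if p < P then M else 1) * ((p ^ n.factorization p : ℕ) : ℝ) ^ ε := by
    intro p hp
    have hp2 : (2 : ℝ) ≤ p := by exact_mod_cast (Nat.prime_of_mem_primeFactors hp).two_le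
    generalize n.factorization p = a
    have hpow : ((p ^ a : ℕ) : ℝ) ^ ε = ((p : ℝ) ^ ε) ^ a := by
      push_cast
      rw [← Real.rpow_natCast, ← Real.rpow_mul (by positivity), mul_comm,
        Real.rpow_mul (by positivity), Real.rpow_natCast]
    rw [hpow]
    split_ifs with h
    · have h1 : 1 + ε * Real.log 2 ≤ (p : ℝ) ^ ε := by
        calc 1 + ε * Real.log 2 ≤ Real.exp (ε * Real.log 2) := by
              linarith [Real.add_one_le_exp (ε * Real.log 2)]
          _ = (2 : ℝ) ^ ε := by rw [Real.rpow_def_of_pos two_pos, mul_comm]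
          _ ≤ _ := Real.rpow_le_rpow (by norm_num) hp2 hε.le
      have h2 : 1 + a * (ε * Real.log 2) ≤ ((p : ℝ) ^ ε) ^ a :=
        (one_add_mul_le_pow (by linarith) a).trans (pow_le_pow_left₀ (by linarith) h1 a)
      calc ((a + 1 : ℕ) : ℝ) ≤ M * (1 + a * (ε * Real.log 2)) := by
            have : M * (1 + a * (ε * Real.log 2)) =
                1 + a * (ε * Real.log 2) + 1 / (ε * Real.log 2) + a := by
              rw [hM]; field_simp; ring
            rw [this]; push_cast
            have := one_div_pos.2 hl
            have : 0 ≤ a * (ε * Real.log 2) := by positivity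
            linarith
        _ ≤ _ := by gcongr
    · have h1 : (2 : ℝ) ≤ (p : ℝ) ^ ε := by
        have hpP : (2 : ℝ) ^ (1 / ε) ≤ p := hP.trans (by exact_mod_cast not_lt.1 h)
        calc (2 : ℝ) = ((2 : ℝ) ^ (1 / ε)) ^ ε := by
              rw [← Real.rpow_mul (by norm_num), one_div_mul_cancel hε.ne', Real.rpow_one]
          _ ≤ _ := Real.rpow_le_rpow (by positivity) hpP hε.le
      rw [one_mul]
      calc ((a + 1 : ℕ) : ℝ) ≤ (2 : ℝ) ^ a := by exact_mod_cast Nat.lt_two_pow_self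
        _ ≤ _ := pow_le_pow_left₀ (by norm_num) h1 a
  calc (n.divisors.card : ℝ) = ∏ p ∈ n.primeFactors, ((n.factorization p + 1 : ℕ) : ℝ) := by
        rw [Nat.card_divisors hn]; push_cast; rfl
    _ ≤ ∏ p ∈ n.primeFactors,
        (if p < P then M else 1) * ((p ^ n.factorization p : ℕ) : ℝ) ^ ε :=
        Finset.prod_le_prod (fun _ _ => by positivity) key
    _ = (∏ p ∈ n.primeFactors, if p < P then M else 1) * (n : ℝ) ^ ε := by
        rw [Finset.prod_mul_distrib, Real.finsetProd_rpow _ _ (fun _ _ => by positivity)]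
        congr 2
        rw [← Nat.cast_prod]
        exact congrArg _ (Nat.prod_factorization_pow_eq_self hn)
    _ ≤ M ^ P * (n : ℝ) ^ ε := by
        gcongr
        rw [Finset.prod_ite, Finset.prod_const, Finset.prod_const_one, mul_one]
        apply pow_le_pow_right₀ hM1
        calc _ ≤ (Finset.range P).card := Finset.card_le_card (by intro p; simp)
          _ = P := Finset.card_range P

/-! ### Coincidences and close pairs -/

theorem card_coincidences_eq_sum {α β κ : Type*} [DecidableEq κ] (S : Finset α) (T : Finset β)
    (f : α → κ) (g : β → κ) (K : Finset κ) (hK : ∀ s ∈ S, f s ∈ K) :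
    (((S ×ˢ T).filter fun q => f q.1 = g q.2).card : ℝ) =
      ∑ k ∈ K, ((S.filter fun s => f s = k).card : ℝ) * (T.filter fun t => g t = k).card := by
  classical
  rw [Finset.card_eq_sum_card_fiberwise (f := fun q => f q.1) (t := K)
    (by intro q hq; simp at hq; exact hK _ hq.1.1)]
  push_cast
  refine Finset.sum_congr rfl fun k _ => ?_
  rw [← Nat.cast_mul, ← Finset.card_product]
  congr 2
  ext ⟨s, t⟩
  simp only [Finset.mem_filter, Finset.mem_product]
  constructor
  · rintro ⟨⟨⟨h1, h2⟩, h3⟩, h4⟩; exact ⟨⟨h1, h4⟩, h2, h3 ▸ h4⟩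
  · rintro ⟨⟨h1, h2⟩, h3, h4⟩; exact ⟨⟨⟨h1, h3⟩, h2.trans h4.symm⟩, h2⟩

/-- Cauchy--Schwarz for the number of coincidences between two maps. -/
theorem sq_card_coincidences_le {α β κ : Type*} [DecidableEq κ] (S : Finset α) (T : Finset β)
    (f : α → κ) (g : β → κ) :
    (((S ×ˢ T).filter fun q => f q.1 = g q.2).card : ℝ) ^ 2 ≤
      ((S ×ˢ S).filter fun q => f q.1 = f q.2).card *
        ((T ×ˢ T).filter fun q => g q.1 = g q.2).card := by
  have hS : ∀ s ∈ S, f s ∈ S.image f ∪ T.image g := fun s hs =>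
    Finset.mem_union_left _ (Finset.mem_image_of_mem f hs)
  have hT : ∀ t ∈ T, g t ∈ S.image f ∪ T.image g := fun t ht =>
    Finset.mem_union_right _ (Finset.mem_image_of_mem g ht)
  rw [card_coincidences_eq_sum S T f g _ hS, card_coincidences_eq_sum S S f f _ hS,
    card_coincidences_eq_sum T T g g _ hT]
  simpa only [sq] using Finset.sum_mul_sq_le_sq_mul_sq (S.image f ∪ T.image g) _ _

/-- The number of pairs of points of `z` at distance less than `ℓ`. -/
noncomputable def closePairs {ι : Type*} (D : Finset ι) (z : ι → ℝ) (ℓ : ℝ) : ℕ :=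
  ((D ×ˢ D).filter fun q => |z q.1 - z q.2| < ℓ).card

theorem abs_sub_lt_one_of_floor_eq {a b : ℝ} (h : ⌊a⌋ = ⌊b⌋) : |a - b| < 1 :=
  Int.abs_sub_lt_one_of_floor_eq_floor h

theorem card_floor_eq_le_closePairs {ι : Type*} (D : Finset ι) (z : ι → ℝ) {u : ℝ} (hu : 0 < u) :
    ((D ×ˢ D).filter fun q => ⌊u * z q.1⌋ = ⌊u * z q.2⌋).card ≤ closePairs D z (1 / u) := by
  apply Finset.card_le_card
  intro q
  simp only [Finset.mem_filter]
  rintro ⟨h, h1⟩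
  refine ⟨h, ?_⟩
  have := abs_sub_lt_one_of_floor_eq h1
  rw [← mul_sub, abs_mul, abs_of_pos hu] at this
  rw [lt_div_iff₀ hu]; linarith

theorem closePairs_mono {ι : Type*} (D : Finset ι) (z : ι → ℝ) {ℓ m : ℝ} (h : ℓ ≤ m) :
    closePairs D z ℓ ≤ closePairs D z m := by
  apply Finset.card_le_card
  intro q
  simp only [Finset.mem_filter]
  exact fun h1 => ⟨h1.1, h1.2.trans_le h⟩

/-- Coincidences up to a shift are controlled by exact coincidences. -/
theorem card_shift_le {α : Type*} (S : Finset α) (f : α → ℤ) (k : ℤ) :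
    ((S ×ˢ S).filter fun q => f q.1 - f q.2 = k).card ≤
      ((S ×ˢ S).filter fun q => f q.1 = f q.2).card := by
  -- Shifting `g` by `k` leaves its self-coincidences unchanged, so both factors on the right are
  -- the same number.
  have h := sq_card_coincidences_le S S f (fun s => f s + k)
  simp only [add_left_inj] at h
  rw [← sq] at h
  have h2 := abs_le_of_sq_le_sq h (by positivity)
  have : ((S ×ˢ S).filter fun q => f q.1 - f q.2 = k) =
      ((S ×ˢ S).filter fun q => f q.1 = f q.2 + k) := by
    apply Finset.filter_congr; intro q _; omega
  rw [this]
  exact_mod_cast (le_abs_self _).trans h2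

/-- Points at distance less than `ℓ` have floors differing by one of `2R + 1` integers, and each
fixed difference occurs at most as often as equality of floors, which forces distance less than 1.
-/
theorem closePairs_le_mul {ι : Type*} (D : Finset ι) (z : ι → ℝ) {ℓ : ℝ} (hℓ : 0 ≤ ℓ) :
    (closePairs D z ℓ : ℝ) ≤ (2 * ℓ + 5) * closePairs D z 1 := by
  classical
  set R : ℤ := ⌈ℓ⌉ + 1
  have hR : (R : ℝ) < ℓ + 2 := by
    have := Int.ceil_lt_add_one ℓ
    simp only [R]; push_cast; linarith
  have hR0 : 0 ≤ R := by have := Int.ceil_nonneg hℓ; simp only [R]; linarith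
  have h1 : closePairs D z ℓ ≤ ∑ k ∈ Finset.Icc (-R) R,
      ((D ×ˢ D).filter fun q => ⌊z q.1⌋ - ⌊z q.2⌋ = k).card := by
    rw [closePairs]
    refine le_trans ?_ (Finset.card_biUnion_le)
    apply Finset.card_le_card
    intro q
    simp only [Finset.mem_filter, Finset.mem_biUnion, Finset.mem_Icc]
    rintro ⟨hq, hlt⟩
    refine ⟨_, ?_, hq, rfl⟩
    rw [abs_lt] at hlt
    have a1 := Int.floor_le (z q.1)
    have a2 := Int.lt_floor_add_one (z q.1)
    have a3 := Int.floor_le (z q.2)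
    have a4 := Int.lt_floor_add_one (z q.2)
    have a5 := Int.le_ceil ℓ
    constructor
    · have : -((R : ℤ) : ℝ) < ((⌊z q.1⌋ - ⌊z q.2⌋ : ℤ) : ℝ) + 1 := by
        simp only [R]; push_cast; linarith
      have : -R < ⌊z q.1⌋ - ⌊z q.2⌋ + 1 := by exact_mod_cast this
      omega
    · have : ((⌊z q.1⌋ - ⌊z q.2⌋ : ℤ) : ℝ) < (R : ℝ) := by
        simp only [R]; push_cast; linarith
      have : ⌊z q.1⌋ - ⌊z q.2⌋ < R := by exact_mod_cast this
      omega
  have h2 : ∑ k ∈ Finset.Icc (-R) R, ((D ×ˢ D).filter fun q => ⌊z q.1⌋ - ⌊z q.2⌋ = k).card ≤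
      ∑ k ∈ Finset.Icc (-R) R, closePairs D z 1 := by
    refine Finset.sum_le_sum fun k _ => ?_
    refine (card_shift_le D (fun p => ⌊z p⌋) k).trans ?_
    simpa using card_floor_eq_le_closePairs D z one_pos
  rw [Finset.sum_const, Int.card_Icc, smul_eq_mul] at h2
  have h3 : (closePairs D z ℓ : ℝ) ≤ (((R + 1 - -R).toNat : ℕ) : ℝ) * closePairs D z 1 := by
    exact_mod_cast h1.trans h2
  refine h3.trans ?_
  gcongr
  have : (((R + 1 - -R).toNat : ℕ) : ℝ) = ((R + 1 - -R : ℤ) : ℝ) := by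
    exact_mod_cast Int.toNat_of_nonneg (by omega)
  rw [this]; push_cast; linarith

/-! ### Close pairs after dilation by integers -/

theorem sum_one_div_sqrt_le (B : ℕ) :
    ∑ n ∈ Finset.range (B + 1), 1 / Real.sqrt n ≤ 2 * Real.sqrt B := by
  induction B with
  | zero => simp
  | succ B ih =>
    rw [Finset.sum_range_succ]
    have h0 : 0 < Real.sqrt ((B + 1 : ℕ) : ℝ) := Real.sqrt_pos.2 (by positivity)
    have h1 : Real.sqrt ((B + 1 : ℕ) : ℝ) ^ 2 = B + 1 := by
      rw [Real.sq_sqrt (by positivity)]; push_cast; ring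
    have h2 : Real.sqrt (B : ℝ) ^ 2 = B := Real.sq_sqrt (by positivity)
    have h3 : 1 / Real.sqrt ((B + 1 : ℕ) : ℝ) ≤
        2 * Real.sqrt ((B + 1 : ℕ) : ℝ) - 2 * Real.sqrt B := by
      rw [div_le_iff₀ h0]
      nlinarith [sq_nonneg (Real.sqrt ((B + 1 : ℕ) : ℝ) - Real.sqrt B)]
    linarith

/-- The number of pairs whose `τ⁻¹ u`-dilates have the same integer part. -/
noncomputable def dilatePairs {ι : Type*} (D : Finset ι) (z : ι → ℝ) (τ : ℝ) (u : ℤ) : ℕ :=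
  ((D ×ˢ D).filter fun q => ⌊u * z q.1 / τ⌋ = ⌊u * z q.2 / τ⌋).card

/-- After scaling by `1/τ` the two floors differ by -1, 0 or 1. For each of these shifts,
Cauchy–Schwarz separates `u` from `v`. -/
theorem card_dilate_close_le {ι : Type*} (D : Finset ι) (z : ι → ℝ) {τ : ℝ} (hτ : 0 < τ)
    (u v : ℤ) :
    (((D ×ˢ D).filter fun q => |u * z q.1 - v * z q.2| < τ).card : ℝ) ≤
      3 * (Real.sqrt (dilatePairs D z τ u) * Real.sqrt (dilatePairs D z τ v)) := by
  classical
  have h1 : ((D ×ˢ D).filter fun q => |u * z q.1 - v * z q.2| < τ).card ≤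
      ∑ k ∈ Finset.Icc (-1 : ℤ) 1,
        ((D ×ˢ D).filter fun q => ⌊u * z q.1 / τ⌋ = ⌊v * z q.2 / τ⌋ + k).card := by
    refine le_trans (Finset.card_le_card ?_) Finset.card_biUnion_le
    intro q
    simp only [Finset.mem_filter, Finset.mem_biUnion, Finset.mem_Icc]
    rintro ⟨hq, hlt⟩
    refine ⟨⌊u * z q.1 / τ⌋ - ⌊v * z q.2 / τ⌋, ?_, hq, by ring⟩
    have hlt' : |u * z q.1 / τ - v * z q.2 / τ| < 1 := by
      rw [← sub_div, abs_div, abs_of_pos hτ, div_lt_one hτ]; exact hlt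
    rw [abs_lt] at hlt'
    have a1 := Int.floor_le (u * z q.1 / τ)
    have a2 := Int.lt_floor_add_one (u * z q.1 / τ)
    have a3 := Int.floor_le (v * z q.2 / τ)
    have a4 := Int.lt_floor_add_one (v * z q.2 / τ)
    constructor
    · have : ((-2 : ℤ) : ℝ) < ((⌊u * z q.1 / τ⌋ - ⌊v * z q.2 / τ⌋ : ℤ) : ℝ) := by
        push_cast; linarith
      have := Int.cast_lt.1 this
      omega
    · have : ((⌊u * z q.1 / τ⌋ - ⌊v * z q.2 / τ⌋ : ℤ) : ℝ) < ((2 : ℤ) : ℝ) := by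
        push_cast; linarith
      have := Int.cast_lt.1 this
      omega
  have h2 : ∀ k : ℤ, (((D ×ˢ D).filter fun q =>
      ⌊u * z q.1 / τ⌋ = ⌊v * z q.2 / τ⌋ + k).card : ℝ) ≤
      Real.sqrt (dilatePairs D z τ u) * Real.sqrt (dilatePairs D z τ v) := by
    intro k
    rw [← Real.sqrt_mul (by positivity)]
    apply Real.le_sqrt_of_sq_le
    have := sq_card_coincidences_le D D (fun p => ⌊u * z p / τ⌋) (fun p => ⌊v * z p / τ⌋ + k)
    simpa only [add_left_inj, dilatePairs] using this
  calc _ ≤ ∑ k ∈ Finset.Icc (-1 : ℤ) 1,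
        (((D ×ˢ D).filter fun q => ⌊u * z q.1 / τ⌋ = ⌊v * z q.2 / τ⌋ + k).card : ℝ) := by
        exact_mod_cast h1
    _ ≤ ∑ k ∈ Finset.Icc (-1 : ℤ) 1,
        Real.sqrt (dilatePairs D z τ u) * Real.sqrt (dilatePairs D z τ v) :=
        Finset.sum_le_sum fun k _ => h2 k
    _ = _ := by simp

/-- Equal floors force distance below `24A/|u|`, so `closePairs_le_mul` applies. Since `|u| ≤ C A`,
the factor `48A/|u| + 5` is at most `53 C A/|u|`; 64 is a convenient square above it. -/
theorem sqrt_dilatePairs_le {ι : Type*} (D : Finset ι) (z : ι → ℝ) {A C : ℕ} (hA : 0 < A)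
    (hC : 0 < C) {u : ℤ} (hu0 : u ≠ 0) (hu : |u| ≤ (C * A : ℕ)) :
    Real.sqrt (dilatePairs D z (24 * A) u) ≤
      8 * Real.sqrt (C * A * closePairs D z 1) * (1 / Real.sqrt (u.natAbs : ℝ)) := by
  have hA' : (1 : ℝ) ≤ A := by exact_mod_cast hA
  have hC' : (1 : ℝ) ≤ C := by exact_mod_cast hC
  have hn : (0 : ℝ) < u.natAbs := by exact_mod_cast Int.natAbs_pos.2 hu0
  have habs : |(u : ℝ)| = u.natAbs := by rw [Nat.cast_natAbs]; push_cast; rfl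
  have hn2 : (u.natAbs : ℝ) ≤ C * A := by
    have : ((|u| : ℤ) : ℝ) ≤ ((C * A : ℕ) : ℝ) := by exact_mod_cast hu
    rw [← habs]; push_cast at this; exact this
  have h1 : dilatePairs D z (24 * A) u ≤ closePairs D z (24 * A / u.natAbs) := by
    apply Finset.card_le_card
    intro q
    simp only [Finset.mem_filter]
    rintro ⟨h, h1⟩
    refine ⟨h, ?_⟩
    have := abs_sub_lt_one_of_floor_eq h1
    rw [← sub_div, ← mul_sub, abs_div, abs_mul, habs,
      abs_of_pos (show (0 : ℝ) < 24 * A by positivity), div_lt_one (by positivity)] at this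
    rw [lt_div_iff₀ hn]; linarith
  have h2 := closePairs_le_mul D z (ℓ := 24 * A / u.natAbs) (by positivity)
  have h3 : (dilatePairs D z (24 * A) u : ℝ) ≤
      64 * (C * A * closePairs D z 1) / u.natAbs := by
    calc (dilatePairs D z (24 * A) u : ℝ) ≤ closePairs D z (24 * A / u.natAbs) := by
          exact_mod_cast h1
      _ ≤ _ := h2
      _ ≤ (64 * (C * A) / u.natAbs) * closePairs D z 1 := by
          gcongr
          rw [mul_div_assoc', div_add' _ _ _ hn.ne']
          gcongr
          nlinarith
      _ = _ := by ring
  calc _ ≤ Real.sqrt (64 * (C * A * closePairs D z 1) / u.natAbs) := Real.sqrt_le_sqrt h3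
    _ = _ := by
      rw [Real.sqrt_div' _ hn.le, Real.sqrt_mul (by norm_num),
        show (64 : ℝ) = 8 ^ 2 by norm_num, Real.sqrt_sq (by norm_num)]
      ring

/-- The dilation `u = 0` identifies all points and gives `D.card`. The others decay like
`|u|^{-1/2}`, and summing up to `C A` gains a second factor `√(C A)`. -/
theorem sum_sqrt_dilatePairs_le {ι : Type*} (D : Finset ι) (z : ι → ℝ) {A C : ℕ} (hA : 0 < A)
    (hC : 0 < C) :
    ∑ u ∈ Finset.Icc (-((C * A : ℕ) : ℤ)) (C * A : ℕ),
      Real.sqrt (dilatePairs D z (24 * A) u) ≤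
      D.card + 32 * (C * A * Real.sqrt (closePairs D z 1)) := by
  set K := 8 * Real.sqrt (C * A * closePairs D z 1) with hK
  set g : ℤ → ℝ := fun u => if u = 0 then (D.card : ℝ) else K * (1 / Real.sqrt (u.natAbs : ℝ))
  have hg : ∀ u ∈ Finset.Icc (-((C * A : ℕ) : ℤ)) (C * A : ℕ),
      Real.sqrt (dilatePairs D z (24 * A) u) ≤ g u := by
    intro u hu
    rw [Finset.mem_Icc] at hu
    by_cases h0 : u = 0
    · subst h0
      simp [g, dilatePairs]
    · simp only [g, h0, if_false]
      exact sqrt_dilatePairs_le D z hA hC h0 (abs_le.2 hu)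
  refine (Finset.sum_le_sum hg).trans ?_
  have heven : Function.Even g := by intro u; simp [g]
  rw [Finset.sum_Icc_of_even_eq_range heven, Finset.sum_range_succ']
  have h1 : ∑ k ∈ Finset.range (C * A), g ((k + 1 : ℕ) : ℤ) =
      K * ∑ k ∈ Finset.range (C * A), 1 / Real.sqrt ((k + 1 : ℕ) : ℝ) := by
    rw [Finset.mul_sum]
    refine Finset.sum_congr rfl fun k _ => ?_
    have : ((k + 1 : ℕ) : ℤ) ≠ 0 := by omega
    simp only [g, this, if_false]
    rfl
  have h2 := sum_one_div_sqrt_le (C * A)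
  rw [Finset.sum_range_succ'] at h2
  have h3 : K * ∑ k ∈ Finset.range (C * A), 1 / Real.sqrt ((k + 1 : ℕ) : ℝ) ≤
      16 * (C * A * Real.sqrt (closePairs D z 1)) := by
    calc _ ≤ K * (2 * Real.sqrt ((C * A : ℕ) : ℝ)) := by
          gcongr
          simpa using h2
      _ = _ := by
        have : Real.sqrt (C * A * closePairs D z 1) =
            Real.sqrt ((C * A : ℕ) : ℝ) * Real.sqrt (closePairs D z 1) := by
          rw [← Real.sqrt_mul (by positivity)]; push_cast; rfl
        have h4 : Real.sqrt ((C * A : ℕ) : ℝ) * Real.sqrt ((C * A : ℕ) : ℝ) = C * A := by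
          rw [Real.mul_self_sqrt (by positivity)]; push_cast; rfl
        rw [hK, this, ← h4]; ring
  rw [h1]
  simp only [g, Nat.cast_zero, if_true, two_nsmul]
  linarith

/-! ### Integer points in strips -/

/-- The number of small integer points in a strip around the line `y u = y' v`. -/
noncomputable def stripCount (B : ℕ) (τ y y' : ℝ) : ℕ :=
  ((Finset.Icc (-(B : ℤ)) B ×ˢ Finset.Icc (-(B : ℤ)) B).filter
    fun w => |w.1 * y - w.2 * y'| < τ).card

theorem stripCount_swap_le (B : ℕ) (τ y y' : ℝ) : stripCount B τ y y' ≤ stripCount B τ y' y := by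
  apply Finset.card_le_card_of_injOn Prod.swap _ (Prod.swap_injective.injOn)
  intro w hw
  simp only [Finset.coe_filter, Finset.mem_product, Set.mem_ofPred_eq] at hw ⊢
  exact ⟨⟨hw.1.2, hw.1.1⟩, by rw [abs_sub_comm]; exact hw.2⟩

/-- The number of positive integer points in a strip around the line `y u = y' v`. -/
noncomputable def posStripCount (A : ℕ) (y y' : ℝ) : ℕ :=
  ((Finset.Ico 1 (4 * A ^ 2) ×ˢ Finset.Ico 1 (4 * A ^ 2)).filter
    fun w : ℕ × ℕ => |w.1 * y - w.2 * y'| < 12 * A).card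

theorem posStripCount_swap_le (A : ℕ) (y y' : ℝ) : posStripCount A y y' ≤ posStripCount A y' y := by
  apply Finset.card_le_card_of_injOn Prod.swap _ (Prod.swap_injective.injOn)
  intro w hw
  simp only [Finset.coe_filter, Finset.mem_product, Set.mem_ofPred_eq] at hw ⊢
  exact ⟨⟨hw.1.2, hw.1.1⟩, by rw [abs_sub_comm]; exact hw.2⟩

/-- Cut the range of `u` into `4A` blocks of length `A` and subtract a fixed point of the same
block. The differences lie in a strip of doubled width with `|Δu| ≤ A`; since `y ≤ y'` and `y' ≥ c`,
also `|Δv| ≤ (1 + 24/c) A`. This is why `u` must go with the smaller of `y` and `y'`. -/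
theorem posStripCount_le_of_le {A C : ℕ} (hA : 0 < A) {c y y' : ℝ} (hc : 0 < c)
    (hC : 1 + 24 / c ≤ C) (hy : c ≤ y) (hyy : y ≤ y') :
    posStripCount A y y' ≤ stripCount (C * A) (24 * A) y y' * (4 * A) := by
  have hA' : (0 : ℝ) < A := by exact_mod_cast hA
  have hy0 : 0 ≤ y := by linarith
  have hy' : 0 < y' := by linarith
  have hC1 : 1 ≤ C := by
    have : 0 < 24 / c := by positivity
    have : (1 : ℝ) ≤ C := by linarith
    exact_mod_cast this
  rw [← Finset.card_range (4 * A)]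
  refine Finset.card_le_mul_card_image_of_maps_to (f := fun w : ℕ × ℕ => w.1 / A) ?_ _ ?_
  · intro w hw
    simp only [Finset.mem_filter, Finset.mem_product, Finset.mem_Ico] at hw
    rw [Finset.mem_range, Nat.div_lt_iff_lt_mul hA]
    nlinarith [hw.1.1.2]
  intro b _
  rcases Finset.eq_empty_or_nonempty (((Finset.Ico 1 (4 * A ^ 2) ×ˢ Finset.Ico 1 (4 * A ^ 2)).filter
    fun w : ℕ × ℕ => |w.1 * y - w.2 * y'| < 12 * A).filter fun w => w.1 / A = b) with h | ⟨w0, hw0⟩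
  · rw [h]; simp
  simp only [Finset.mem_filter] at hw0
  apply Finset.card_le_card_of_injOn
    (fun w : ℕ × ℕ => ((w.1 : ℤ) - w0.1, (w.2 : ℤ) - w0.2))
  · intro w hw
    simp only [Finset.coe_filter, Finset.mem_filter, Set.mem_ofPred_eq] at hw
    simp only [Finset.coe_filter, Finset.mem_product, Finset.mem_Icc, Set.mem_ofPred_eq,
      ← abs_le]
    obtain ⟨⟨_, h0⟩, h0b⟩ := hw0
    obtain ⟨⟨_, h1⟩, h1b⟩ := hw
    have hu : |(w.1 : ℤ) - w0.1| ≤ A := by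
      have e1 := Nat.div_add_mod w.1 A
      have e0 := Nat.div_add_mod w0.1 A
      have m1 := Nat.mod_lt w.1 hA
      have m0 := Nat.mod_lt w0.1 hA
      rw [h1b] at e1
      rw [h0b] at e0
      rw [abs_le]
      constructor <;> omega
    have hstrip : |((w.1 : ℝ) - w0.1) * y - ((w.2 : ℝ) - w0.2) * y'| < 24 * A := by
      rw [abs_lt] at h0 h1 ⊢
      constructor <;> linarith
    refine ⟨⟨hu.trans ?_, ?_⟩, by push_cast; exact hstrip⟩
    · push_cast
      nlinarith [(by exact_mod_cast hC1 : (1 : ℤ) ≤ C), (by exact_mod_cast hA : (0 : ℤ) < A)]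
    · have hu' : |(w.1 : ℝ) - w0.1| ≤ A := by exact_mod_cast hu
      have hv : |(w.2 : ℝ) - w0.2| * y' ≤ A * y' + 24 * A := by
        have t1 : |((w.2 : ℝ) - w0.2) * y'| ≤ |((w.1 : ℝ) - w0.1) * y| +
            |((w.1 : ℝ) - w0.1) * y - ((w.2 : ℝ) - w0.2) * y'| := by
          have := abs_sub_abs_le_abs_sub (((w.2 : ℝ) - w0.2) * y') (((w.1 : ℝ) - w0.1) * y)
          rw [abs_sub_comm] at this
          linarith
        rw [abs_mul, abs_of_pos hy', abs_mul, abs_of_pos (by linarith : 0 < y)] at t1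
        have t2 : |(w.1 : ℝ) - w0.1| * y ≤ A * y' := by gcongr
        linarith
      have hv2 : |(w.2 : ℝ) - w0.2| ≤ (C * A : ℕ) := by
        have t3 : 24 * (A : ℝ) ≤ (24 / c * A) * y' := by
          have : 24 * (A : ℝ) = (24 / c * A) * c := by field_simp
          rw [this]
          have : 0 < 24 / c * A := by positivity
          gcongr
          linarith
        have t4 : |(w.2 : ℝ) - w0.2| * y' ≤ ((1 + 24 / c) * A) * y' := by linarith
        have t5 := le_of_mul_le_mul_right t4 hy'
        push_cast
        refine t5.trans ?_
        gcongr
      exact_mod_cast hv2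
  · intro w _ w' _ h
    simp only [Prod.mk.injEq] at h
    ext <;> omega

theorem posStripCount_le {A C : ℕ} (hA : 0 < A) {c y y' : ℝ} (hc : 0 < c)
    (hC : 1 + 24 / c ≤ C) (hy : c ≤ y) (hy' : c ≤ y') :
    posStripCount A y y' ≤ stripCount (C * A) (24 * A) y y' * (4 * A) := by
  rcases le_total y y' with h | h
  · exact posStripCount_le_of_le hA hc hC hy h
  · refine (posStripCount_swap_le A y y').trans ((posStripCount_le_of_le hA hc hC hy' h).trans ?_)
    exact Nat.mul_le_mul_right _ (stripCount_swap_le _ _ _ _)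

/-- Exchange the order of counting: for fixed `(u, v)` the pairs of points are counted by
`card_dilate_close_le`, whose bound is a product, so the double sum becomes a square. -/
theorem sum_stripCount_le {ι : Type*} (D : Finset ι) (z : ι → ℝ) {A C : ℕ} (hA : 0 < A)
    (hC : 0 < C) :
    ∑ q ∈ D ×ˢ D, (stripCount (C * A) (24 * A) (z q.1) (z q.2) : ℝ) ≤
      3 * (D.card + 32 * (C * A * Real.sqrt (closePairs D z 1))) ^ 2 := by
  have hA' : (0 : ℝ) < A := by exact_mod_cast hA
  set I := Finset.Icc (-((C * A : ℕ) : ℤ)) (C * A : ℕ) with hI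
  calc ∑ q ∈ D ×ˢ D, (stripCount (C * A) (24 * A) (z q.1) (z q.2) : ℝ)
      = ∑ w ∈ I ×ˢ I, (((D ×ˢ D).filter
          fun q => |w.1 * z q.1 - w.2 * z q.2| < 24 * A).card : ℝ) := by
        simp only [stripCount, Finset.card_filter, Nat.cast_sum]
        rw [Finset.sum_comm]
    _ ≤ ∑ w ∈ I ×ˢ I, 3 * (Real.sqrt (dilatePairs D z (24 * A) w.1) *
          Real.sqrt (dilatePairs D z (24 * A) w.2)) :=
        Finset.sum_le_sum fun w _ => card_dilate_close_le D z (by positivity) w.1 w.2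
    _ = 3 * (∑ u ∈ I, Real.sqrt (dilatePairs D z (24 * A) u)) ^ 2 := by
        rw [← Finset.mul_sum, sq, Finset.sum_mul_sum, Finset.sum_product]
    _ ≤ _ := by
        gcongr
        exact sum_sqrt_dilatePairs_le D z hA hC

/-! ### The energy of dilated differences -/

/-- Quadruples `((a, p), (b, q))` with `a, b ∈ [A, 2A)` and `|a z p - b z q| < 1`. -/
noncomputable def dilateEnergy {ι : Type*} (D : Finset ι) (z : ι → ℝ) (A : ℕ) : ℕ :=
  (((Finset.Ico A (2 * A) ×ˢ D) ×ˢ (Finset.Ico A (2 * A) ×ˢ D)).filter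
    fun w : (ℕ × ι) × (ℕ × ι) => |w.1.1 * z w.1.2 - w.2.1 * z w.2.2| < 1).card

/-- Pairs of triples `(a, b, q)`, `(c, d, r)` with `a, b, c, d ∈ [A, 2A)` and
`|c b z q - a d z r| < 12 A`. -/
noncomputable def crossDilates {ι : Type*} (D : Finset ι) (z : ι → ℝ) (A : ℕ) :
    Finset ((ℕ × ℕ × ι) × (ℕ × ℕ × ι)) :=
  ((Finset.Ico A (2 * A) ×ˢ Finset.Ico A (2 * A) ×ˢ D) ×ˢ
    (Finset.Ico A (2 * A) ×ˢ Finset.Ico A (2 * A) ×ˢ D)).filter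
    fun w => |(w.2.1 * w.1.2.1 : ℕ) * z w.1.2.2 - (w.1.1 * w.2.2.1 : ℕ) * z w.2.2.2| < 12 * A

theorem card_int_near_le (s : Finset ℤ) (x : ℝ) (h : ∀ k ∈ s, |(k : ℝ) - x| < 3) :
    s.card ≤ 7 := by
  have : s ⊆ Finset.Icc (⌊x⌋ - 3) (⌊x⌋ + 3) := by
    intro k hk
    have h1 := abs_lt.1 (h k hk)
    have a1 := Int.floor_le x
    have a2 := Int.lt_floor_add_one x
    rw [Finset.mem_Icc]
    constructor
    · have : ((⌊x⌋ - 3 : ℤ) : ℝ) < ((k + 1 : ℤ) : ℝ) := by push_cast; linarith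
      have := Int.cast_lt.1 this
      omega
    · have : (k : ℝ) < ((⌊x⌋ + 4 : ℤ) : ℝ) := by push_cast; linarith
      have := Int.cast_lt.1 this
      omega
  refine (Finset.card_le_card this).trans ?_
  rw [Int.card_Icc]
  omega

/-- Replace `z p` by `k/A` with `k = ⌊A z p⌋`, at a cost of at most 2 in `a z p`, and apply
Cauchy–Schwarz over `k`. Coincidences among the `p` are close pairs. Two triples sharing the same
`k` satisfy the relation of `crossDilates`, since `3c + 3a < 12A`. -/
theorem sq_dilateEnergy_le {ι : Type*} (D : Finset ι) (z : ι → ℝ) {A : ℕ} (hA : 0 < A) :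
    (dilateEnergy D z A : ℝ) ^ 2 ≤ closePairs D z 1 * (7 * (crossDilates D z A).card) := by
  classical
  have hA' : (0 : ℝ) < A := by exact_mod_cast hA
  set I := Finset.Ico A (2 * A) with hI
  have hmem : ∀ a ∈ I, (A : ℝ) ≤ a ∧ (a : ℝ) < 2 * A := by
    intro a ha
    rw [hI, Finset.mem_Ico] at ha
    exact ⟨by exact_mod_cast ha.1, by exact_mod_cast ha.2⟩
  set f : ι → ℤ := fun p => ⌊A * z p⌋ with hf
  set T : Finset ((ℕ × ℕ × ι) × ℤ) := ((I ×ˢ I ×ˢ D) ×ˢ D.image f).filter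
    fun t => |t.1.1 * (t.2 / A : ℝ) - t.1.2.1 * z t.1.2.2| < 3 with hT
  have h1 : dilateEnergy D z A ≤ ((D ×ˢ T).filter fun w => f w.1 = w.2.2).card := by
    apply Finset.card_le_card_of_injOn
      (fun w : (ℕ × ι) × (ℕ × ι) => (w.1.2, ((w.1.1, w.2.1, w.2.2), f w.1.2)))
    · intro w hw
      simp only [Finset.coe_filter, Finset.mem_product, Set.mem_ofPred_eq] at hw
      obtain ⟨⟨⟨h1, h2⟩, h3, h4⟩, h5⟩ := hw
      simp only [Finset.coe_filter, Finset.mem_product, Set.mem_ofPred_eq, hT, Finset.mem_filter]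
      refine ⟨⟨h2, ⟨⟨h1, h3, h4⟩, Finset.mem_image_of_mem f h2⟩, ?_⟩, trivial⟩
      have a1 := Int.floor_le (A * z w.1.2)
      have a2 := Int.lt_floor_add_one (A * z w.1.2)
      have b1 : (f w.1.2 : ℝ) / A ≤ z w.1.2 := by
        rw [div_le_iff₀ hA']; simp only [hf]; linarith
      have b2 : z w.1.2 < (f w.1.2 : ℝ) / A + 1 / A := by
        rw [← add_div, lt_div_iff₀ hA']; simp only [hf]; linarith
      obtain ⟨c1, c2⟩ := hmem _ h1
      have c0 : (0 : ℝ) < w.1.1 := by linarith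
      have b3 : (w.1.1 : ℝ) * (f w.1.2 / A) ≤ w.1.1 * z w.1.2 := by gcongr
      have b4 : (w.1.1 : ℝ) * z w.1.2 < w.1.1 * (f w.1.2 / A) + 2 := by
        calc (w.1.1 : ℝ) * z w.1.2 < w.1.1 * (f w.1.2 / A + 1 / A) := by gcongr
          _ = w.1.1 * (f w.1.2 / A) + w.1.1 / A := by ring
          _ ≤ _ := by
            have : (w.1.1 : ℝ) / A ≤ 2 := by rw [div_le_iff₀ hA']; linarith
            linarith
      rw [abs_lt] at h5 ⊢
      constructor <;> linarith
    · intro w _ w' _ h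
      simp only [Prod.mk.injEq] at h
      ext1 <;> ext1 <;> tauto
  have h2 := sq_card_coincidences_le D T f (fun t => t.2)
  have h3 : ((D ×ˢ D).filter fun q => f q.1 = f q.2).card ≤ closePairs D z 1 :=
    (card_floor_eq_le_closePairs D z hA').trans (closePairs_mono D z (by
      rw [div_le_one hA']; exact_mod_cast hA))
  have h4 : ((T ×ˢ T).filter fun q => q.1.2 = q.2.2).card ≤ 7 * (crossDilates D z A).card := by
    refine Finset.card_le_mul_card_image_of_maps_to
      (f := fun w : ((ℕ × ℕ × ι) × ℤ) × ((ℕ × ℕ × ι) × ℤ) => (w.1.1, w.2.1)) ?_ _ ?_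
    · rintro ⟨⟨⟨a, b, q⟩, k⟩, ⟨c, d, r⟩, k'⟩ hw
      simp only [Finset.mem_filter, Finset.mem_product, hT] at hw
      obtain ⟨⟨⟨⟨⟨ha, hb, hq⟩, _⟩, h5⟩, ⟨⟨hc, hd, hr⟩, _⟩, h6⟩, h7⟩ := hw
      subst h7
      simp only [crossDilates, Finset.mem_filter, Finset.mem_product]
      refine ⟨⟨⟨ha, hb, hq⟩, hc, hd, hr⟩, ?_⟩
      obtain ⟨a1, a2⟩ := hmem _ ha
      obtain ⟨c1, c2⟩ := hmem _ hc
      have e : ((c * b : ℕ) : ℝ) * z q - (a * d : ℕ) * z r =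
          -(c * (a * (k / A : ℝ) - b * z q)) + a * (c * (k / A : ℝ) - d * z r) := by
        push_cast; ring
      rw [e]
      refine (abs_add_le _ _).trans_lt ?_
      rw [abs_neg, abs_mul, abs_mul, Nat.abs_cast, Nat.abs_cast]
      have i1 : (c : ℝ) * |a * (k / A : ℝ) - b * z q| < c * 3 := by
        have : (0 : ℝ) < c := by linarith
        gcongr
      have i2 : (a : ℝ) * |c * (k / A : ℝ) - d * z r| < a * 3 := by
        have : (0 : ℝ) < a := by linarith
        gcongr
      linarith
    · rintro ⟨⟨a, b, q⟩, c, d, r⟩ hw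
      simp only [crossDilates, Finset.mem_filter, Finset.mem_product] at hw
      obtain ⟨a1, a2⟩ := hmem _ hw.1.1.1
      have a0 : (0 : ℝ) < a := by linarith
      have hinj : Set.InjOn (fun w : ((ℕ × ℕ × ι) × ℤ) × ((ℕ × ℕ × ι) × ℤ) => w.1.2)
          (((T ×ˢ T).filter fun q => q.1.2 = q.2.2).filter
            fun w => (w.1.1, w.2.1) = ((a, b, q), (c, d, r)) : Finset _) := by
        rintro ⟨⟨t, k⟩, t', k'⟩ h ⟨⟨s, l⟩, s', l'⟩ h' hk
        simp only [Finset.coe_filter, Finset.mem_filter, Set.mem_ofPred_eq, Prod.mk.injEq] at h h' hk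
        obtain ⟨⟨_, h1⟩, h2, h3⟩ := h
        obtain ⟨⟨_, h1'⟩, h2', h3'⟩ := h'
        subst h1 h1' hk
        simp [h2, h3, h2', h3']
      rw [← Finset.card_image_of_injOn hinj]
      -- The triple `(a, b, q)` places `k` within `3A/a ≤ 3` of this point, so at most 7 values of
      -- `k` lie over each pair of triples.
      apply card_int_near_le _ (A * b * z q / a)
      intro k hk
      simp only [Finset.mem_image, Finset.mem_filter, Finset.mem_product, hT] at hk
      obtain ⟨⟨⟨t, l⟩, t', l'⟩, ⟨⟨⟨⟨_, h5⟩, _⟩, _⟩, h6⟩, rfl⟩ := hk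
      simp only [Prod.mk.injEq] at h6
      obtain ⟨h6, -⟩ := h6
      subst h6
      simp only at h5 ⊢
      have e : (l : ℝ) - A * b * z q / a = A / a * (a * (l / A) - b * z q) := by
        field_simp
      rw [e, abs_mul, abs_of_pos (by positivity)]
      have : (A : ℝ) / a ≤ 1 := by rw [div_le_one a0]; exact a1
      calc _ ≤ 1 * |(a : ℝ) * (l / A) - b * z q| := by gcongr
        _ < 3 := by linarith
  calc (dilateEnergy D z A : ℝ) ^ 2
      ≤ (((D ×ˢ T).filter fun w => f w.1 = w.2.2).card : ℝ) ^ 2 := by gcongr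
    _ ≤ _ := h2
    _ ≤ _ := by
      gcongr
      exact_mod_cast h4

/-- Record only the products `u = c b` and `v = a d`. As `c ∣ u`, `a ∣ v`, and `b, d` are then
determined, at most `M ^ 2` configurations share the same products and points. -/
theorem card_crossDilates_le {ι : Type*} (D : Finset ι) (z : ι → ℝ) {A M : ℕ} (hA : 0 < A)
    (hM : ∀ u ∈ Finset.Ico 1 (4 * A ^ 2), u.divisors.card ≤ M) :
    (crossDilates D z A).card ≤ M ^ 2 * ∑ q ∈ D ×ˢ D, posStripCount A (z q.1) (z q.2) := by
  classical
  set U := Finset.Ico 1 (4 * A ^ 2) with hU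
  have hY : ∑ q ∈ D ×ˢ D, posStripCount A (z q.1) (z q.2) =
      (((D ×ˢ D) ×ˢ (U ×ˢ U)).filter fun w : (ι × ι) × (ℕ × ℕ) =>
        |w.2.1 * z w.1.1 - w.2.2 * z w.1.2| < 12 * A).card := by
    simp only [posStripCount, Finset.card_filter]
    rw [Finset.sum_product (D ×ˢ D)]
  rw [hY]
  have hprod : ∀ a b : ℕ, a ∈ Finset.Ico A (2 * A) → b ∈ Finset.Ico A (2 * A) → a * b ∈ U := by
    intro a b ha hb
    simp only [hU, Finset.mem_Ico] at *
    constructor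
    · exact Nat.mul_pos (by omega) (by omega)
    · nlinarith
  refine Finset.card_le_mul_card_image_of_maps_to
    (f := fun w : (ℕ × ℕ × ι) × (ℕ × ℕ × ι) =>
      ((w.1.2.2, w.2.2.2), (w.2.1 * w.1.2.1, w.1.1 * w.2.2.1))) ?_ _ ?_
  · rintro ⟨⟨a, b, q⟩, c, d, r⟩ hw
    simp only [crossDilates, Finset.mem_filter, Finset.mem_product] at hw ⊢
    obtain ⟨⟨⟨ha, hb, hq⟩, hc, hd, hr⟩, h⟩ := hw
    exact ⟨⟨⟨hq, hr⟩, hprod _ _ hc hb, hprod _ _ ha hd⟩, h⟩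
  · rintro ⟨⟨q, r⟩, u, v⟩ hw
    simp only [Finset.mem_filter, Finset.mem_product] at hw
    obtain ⟨⟨_, hu, hv⟩, _⟩ := hw
    have hu0 : u ≠ 0 := by simp only [hU, Finset.mem_Ico] at hu; omega
    have hv0 : v ≠ 0 := by simp only [hU, Finset.mem_Ico] at hv; omega
    calc _ ≤ (u.divisors ×ˢ v.divisors).card := by
          apply Finset.card_le_card_of_injOn
            (fun w : (ℕ × ℕ × ι) × (ℕ × ℕ × ι) => (w.2.1, w.1.1))
          · rintro ⟨⟨a, b, q⟩, c, d, r⟩ hw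
            simp only [Finset.coe_filter, Set.mem_ofPred_eq, Prod.mk.injEq] at hw
            obtain ⟨_, _, h1, h2⟩ := hw
            simp only [Finset.coe_product, Set.mem_prod, Finset.mem_coe, Nat.mem_divisors]
            exact ⟨⟨⟨b, h1.symm⟩, hu0⟩, ⟨d, h2.symm⟩, hv0⟩
          · rintro ⟨⟨a, b, q⟩, c, d, r⟩ hw ⟨⟨a', b', q'⟩, c', d', r'⟩ hw' h
            simp only [Finset.coe_filter, Set.mem_ofPred_eq, Prod.mk.injEq] at hw hw' h
            obtain ⟨_, ⟨e1, e2⟩, h1, h2⟩ := hw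
            obtain ⟨_, ⟨e1', e2'⟩, h1', h2'⟩ := hw'
            obtain ⟨rfl, rfl⟩ := h
            have hc0 : c ≠ 0 := by rintro rfl; simp at h1; exact hu0 h1.symm
            have ha0 : a ≠ 0 := by rintro rfl; simp at h2; exact hv0 h2.symm
            have hb : b = b' := Nat.eq_of_mul_eq_mul_left (Nat.pos_of_ne_zero hc0) (h1.trans h1'.symm)
            have hd : d = d' := Nat.eq_of_mul_eq_mul_left (Nat.pos_of_ne_zero ha0) (h2.trans h2'.symm)
            simp [hb, hd, e1, e2, e1', e2']
      _ ≤ M ^ 2 := by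
          rw [Finset.card_product, sq]
          exact Nat.mul_le_mul (hM u hu) (hM v hv)

theorem dilateEnergy_le {ι : Type*} (D : Finset ι) (z : ι → ℝ) {c : ℝ} (hc : 0 < c)
    (hz : ∀ p ∈ D, c ≤ z p) {C : ℕ} (hC : 1 + 24 / c ≤ C) {A M : ℕ} (hA : 0 < A)
    (hM : ∀ u ∈ Finset.Ico 1 (4 * A ^ 2), u.divisors.card ≤ M) :
    (dilateEnergy D z A : ℝ) ≤ 10 * M * Real.sqrt (A * closePairs D z 1) *
      (D.card + 32 * (C * A * Real.sqrt (closePairs D z 1))) := by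
  have hC1 : 0 < C := by
    have : 0 < 24 / c := by positivity
    have : (0 : ℝ) < C := by linarith
    exact_mod_cast this
  refine (sq_le_sq₀ (by positivity) (by positivity)).1 ?_
  have h1 : ((∑ q ∈ D ×ˢ D, posStripCount A (z q.1) (z q.2) : ℕ) : ℝ) ≤
      3 * (D.card + 32 * (C * A * Real.sqrt (closePairs D z 1))) ^ 2 * (4 * A) := by
    calc ((∑ q ∈ D ×ˢ D, posStripCount A (z q.1) (z q.2) : ℕ) : ℝ)
        ≤ ((∑ q ∈ D ×ˢ D, stripCount (C * A) (24 * A) (z q.1) (z q.2) * (4 * A) : ℕ) : ℝ) := by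
          gcongr with q hq
          rw [Finset.mem_product] at hq
          exact posStripCount_le hA hc hC (hz _ hq.1) (hz _ hq.2)
      _ = (∑ q ∈ D ×ˢ D, (stripCount (C * A) (24 * A) (z q.1) (z q.2) : ℝ)) * (4 * A) := by
          rw [← Finset.sum_mul]; push_cast; rfl
      _ ≤ _ := by
          gcongr
          exact sum_stripCount_le D z hA hC1
  have h2 : ((crossDilates D z A).card : ℝ) ≤ M ^ 2 *
      (3 * (D.card + 32 * (C * A * Real.sqrt (closePairs D z 1))) ^ 2 * (4 * A)) := by
    calc ((crossDilates D z A).card : ℝ)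
        ≤ ((M ^ 2 * ∑ q ∈ D ×ˢ D, posStripCount A (z q.1) (z q.2) : ℕ) : ℝ) := by
          exact_mod_cast card_crossDilates_le D z hA hM
      _ = M ^ 2 * ((∑ q ∈ D ×ˢ D, posStripCount A (z q.1) (z q.2) : ℕ) : ℝ) := by push_cast; rfl
      _ ≤ _ := by gcongr
  set F := (D.card : ℝ) + 32 * (C * A * Real.sqrt (closePairs D z 1))
  calc (dilateEnergy D z A : ℝ) ^ 2 ≤ closePairs D z 1 * (7 * (crossDilates D z A).card) :=
        sq_dilateEnergy_le D z hA
    _ ≤ closePairs D z 1 * (7 * (M ^ 2 * (3 * F ^ 2 * (4 * A)))) := by gcongr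
    _ = 84 * (M ^ 2 * (A * closePairs D z 1) * F ^ 2) := by ring
    -- The constant `84 = 7 · 3 · 4` is rounded up to the square of 10.
    _ ≤ 100 * (M ^ 2 * (A * closePairs D z 1) * F ^ 2) := by gcongr; norm_num
    _ = _ := by
      rw [mul_pow, mul_pow, Real.sq_sqrt (by positivity)]; ring

/-! ### Mean squares of cosine sums under the Gaussian -/

open ProbabilityTheory in
theorem integral_cos_gaussianReal (l : ℝ) :
    ∫ a, Real.cos (l * a) ∂(gaussianReal 0 1) = Real.exp (-(l ^ 2 / 2)) := by
  have h := charFun_gaussianReal (μ := 0) (v := 1) l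
  rw [charFun_apply_real] at h
  have h2 : ∀ a : ℝ, Real.cos (l * a) = RCLike.re (Complex.exp (l * a * Complex.I)) := by
    intro a
    have : ((l : ℂ) * a) = ((l * a : ℝ) : ℂ) := by push_cast; rfl
    rw [this, RCLike.re_eq_complex_re, Complex.exp_ofReal_mul_I_re]
  simp_rw [h2]
  rw [integral_re, h]
  · have : ((l : ℂ) * (0 : ℝ) * Complex.I - ((1 : NNReal) : ℝ) * (l : ℂ) ^ 2 / 2) =
        ((-(l ^ 2 / 2) : ℝ) : ℂ) := by push_cast; ring
    rw [this, RCLike.re_eq_complex_re, Complex.exp_ofReal_re]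
  · refine Integrable.of_bound (C := 1) (by fun_prop) (ae_of_all _ fun a => ?_)
    have : ((l : ℂ) * a) = ((l * a : ℝ) : ℂ) := by push_cast; rfl
    rw [this, Complex.norm_exp_ofReal_mul_I]

-- The product of cosines is the mean of the cosines of difference and sum frequencies. As `l, m ≥
-- 0`, the sum is at least `|l - m|`, so both integrals obey the same bound.
open ProbabilityTheory in
theorem integral_cos_mul_cos_gaussianReal_le {l m : ℝ} (hl : 0 ≤ l) (hm : 0 ≤ m) :
    ∫ a, Real.cos (2 * Real.pi * l * a) * Real.cos (2 * Real.pi * m * a) ∂(gaussianReal 0 1) ≤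
      1 / (1 + (l - m) ^ 2) := by
  have hint : ∀ r : ℝ, Integrable (fun a => Real.cos (r * a)) (gaussianReal 0 1) := fun r =>
    Integrable.of_bound (C := 1) (by fun_prop) (ae_of_all _ fun a => Real.abs_cos_le_one _)
  have h : ∀ a : ℝ, Real.cos (2 * Real.pi * l * a) * Real.cos (2 * Real.pi * m * a) =
      (1 / 2) * (Real.cos ((2 * Real.pi * (l - m)) * a) +
        Real.cos ((2 * Real.pi * (l + m)) * a)) := by
    intro a
    rw [show 2 * Real.pi * (l - m) * a = 2 * Real.pi * l * a - 2 * Real.pi * m * a by ring,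
      show 2 * Real.pi * (l + m) * a = 2 * Real.pi * l * a + 2 * Real.pi * m * a by ring,
      Real.cos_sub, Real.cos_add]
    ring
  simp_rw [h]
  rw [integral_const_mul, integral_add (hint _) (hint _), integral_cos_gaussianReal,
    integral_cos_gaussianReal]
  have key : ∀ r : ℝ, (l - m) ^ 2 ≤ r ^ 2 →
      Real.exp (-((2 * Real.pi * r) ^ 2 / 2)) ≤ 1 / (1 + (l - m) ^ 2) := by
    intro r hr
    rw [Real.exp_neg, ← one_div]
    apply one_div_le_one_div_of_le (by positivity)
    have h1 := Real.add_one_le_exp ((2 * Real.pi * r) ^ 2 / 2)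
    have h2 : r ^ 2 ≤ (2 * Real.pi * r) ^ 2 / 2 := by
      have := Real.pi_gt_three
      have e : (2 * Real.pi * r) ^ 2 / 2 = (2 * Real.pi ^ 2) * r ^ 2 := by ring
      rw [e]
      exact le_mul_of_one_le_left (sq_nonneg r) (by nlinarith)
    linarith
  have k1 := key (l - m) le_rfl
  have k2 := key (l + m) (by nlinarith [mul_nonneg hl hm])
  linarith

theorem summable_three_div_one_add_sq : Summable fun k : ℤ => 3 / (1 + (k : ℝ) ^ 2) := by
  have h1 : Summable fun k : ℤ => 3 * (1 / (k : ℝ) ^ 2 + if k = 0 then 1 else 0) :=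
    ((Real.summable_one_div_int_pow.2 one_lt_two).add (hasSum_ite_eq (0 : ℤ) (1 : ℝ)).summable).mul_left 3
  refine Summable.of_nonneg_of_le (fun k => by positivity) (fun k => ?_) h1
  by_cases h : k = 0
  · simp [h]
  · have : (0 : ℝ) < (k : ℝ) ^ 2 := by positivity
    simp only [h, if_false, add_zero, mul_one_div]
    gcongr
    linarith

open ProbabilityTheory in
/-- Mean square of a cosine sum with bounded nonnegative coefficients. -/
theorem exists_integral_sq_cos_sum_le : ∃ C : ℝ, 0 < C ∧ ∀ {σ : Type} (S : Finset σ)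
    (a l : σ → ℝ) (K : ℝ), (∀ s ∈ S, 0 ≤ a s) → (∀ s ∈ S, a s ≤ K) → (∀ s ∈ S, 0 ≤ l s) →
    ∫ t, (∑ s ∈ S, a s * Real.cos (2 * Real.pi * l s * t)) ^ 2 ∂(gaussianReal 0 1) ≤
      C * K ^ 2 * ((S ×ˢ S).filter fun q => |l q.1 - l q.2| < 1).card := by
  classical
  refine ⟨1 + ∑' k : ℤ, 3 / (1 + (k : ℝ) ^ 2), ?_, ?_⟩
  · have : 0 ≤ ∑' k : ℤ, 3 / (1 + (k : ℝ) ^ 2) := tsum_nonneg fun k => by positivity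
    linarith
  intro σ S a l K ha haK hl
  set f : σ → ℤ := fun s => ⌊l s⌋ with hf
  set G : ℤ → ℝ := fun k => 3 / (1 + (k : ℝ) ^ 2) with hG
  have hG0 : ∀ k, 0 ≤ G k := fun k => by simp only [hG]; positivity
  have hint : ∀ q : σ × σ, Integrable (fun t : ℝ => Real.cos (2 * Real.pi * l q.1 * t) *
      Real.cos (2 * Real.pi * l q.2 * t)) (gaussianReal 0 1) := fun q =>
    Integrable.of_bound (C := 1) (by fun_prop) (ae_of_all _ fun t => by
      rw [norm_mul]
      exact mul_le_one₀ (Real.abs_cos_le_one _) (norm_nonneg _) (Real.abs_cos_le_one _))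
  have h1 : ∀ t : ℝ, (∑ s ∈ S, a s * Real.cos (2 * Real.pi * l s * t)) ^ 2 =
      ∑ q ∈ S ×ˢ S, a q.1 * a q.2 * (Real.cos (2 * Real.pi * l q.1 * t) *
        Real.cos (2 * Real.pi * l q.2 * t)) := by
    intro t
    rw [sq, Finset.sum_mul_sum, Finset.sum_product]
    refine Finset.sum_congr rfl fun s _ => Finset.sum_congr rfl fun s' _ => by ring
  simp_rw [h1]
  rw [integral_finsetSum _ fun q _ => (hint q).const_mul _]
  set I := (S ×ˢ S).image fun q => f q.1 - f q.2 with hI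
  have h2 : ∀ q ∈ S ×ˢ S, ∫ t, a q.1 * a q.2 * (Real.cos (2 * Real.pi * l q.1 * t) *
        Real.cos (2 * Real.pi * l q.2 * t)) ∂(gaussianReal 0 1) ≤ K ^ 2 * G (f q.1 - f q.2) := by
    intro q hq
    rw [Finset.mem_product] at hq
    rw [integral_const_mul]
    have e1 : a q.1 * a q.2 ≤ K ^ 2 := by
      rw [sq]; exact mul_le_mul (haK _ hq.1) (haK _ hq.2) (ha _ hq.2)
        ((ha _ hq.1).trans (haK _ hq.1))
    have e2 := integral_cos_mul_cos_gaussianReal_le (hl _ hq.1) (hl _ hq.2)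
    -- The difference of floors is within 1 of the true difference; the 3 in `G` absorbs this error.
    -- The weights then depend only on an integer `k`, and `card_shift_le` bounds each level set
    -- uniformly.
    have e3 : 1 / (1 + (l q.1 - l q.2) ^ 2) ≤ G (f q.1 - f q.2) := by
      simp only [hG]
      rw [div_le_div_iff₀ (by positivity) (by positivity)]
      have a1 := Int.floor_le (l q.1)
      have a2 := Int.lt_floor_add_one (l q.1)
      have a3 := Int.floor_le (l q.2)
      have a4 := Int.lt_floor_add_one (l q.2)
      have a5 : |((f q.1 - f q.2 : ℤ) : ℝ) - (l q.1 - l q.2)| ≤ 1 := by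
        rw [abs_le]; push_cast; simp only [hf]; constructor <;> linarith
      have a6 := sq_le_one_iff_abs_le_one _ |>.2 a5
      nlinarith [sq_nonneg (((f q.1 - f q.2 : ℤ) : ℝ) - 2 * (l q.1 - l q.2))]
    calc _ ≤ a q.1 * a q.2 * G (f q.1 - f q.2) :=
          mul_le_mul_of_nonneg_left (e2.trans e3) (mul_nonneg (ha _ hq.1) (ha _ hq.2))
      _ ≤ _ := by gcongr
  refine (Finset.sum_le_sum h2).trans ?_
  rw [← Finset.mul_sum]
  set W := ((S ×ˢ S).filter fun q => |l q.1 - l q.2| < 1).card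
  have h3 : ∑ q ∈ S ×ˢ S, G (f q.1 - f q.2) ≤ (1 + ∑' k : ℤ, G k) * W := by
    calc ∑ q ∈ S ×ˢ S, G (f q.1 - f q.2)
        = ∑ k ∈ I, ∑ q ∈ (S ×ˢ S).filter (fun q => f q.1 - f q.2 = k), G (f q.1 - f q.2) :=
          (Finset.sum_fiberwise_of_maps_to (fun q hq => Finset.mem_image_of_mem _ hq) _).symm
      _ = ∑ k ∈ I, (((S ×ˢ S).filter fun q => f q.1 - f q.2 = k).card : ℝ) * G k := by
          refine Finset.sum_congr rfl fun k _ => ?_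
          rw [← nsmul_eq_mul, ← Finset.sum_const]
          refine Finset.sum_congr rfl fun q hq => ?_
          rw [(Finset.mem_filter.1 hq).2]
      _ ≤ ∑ k ∈ I, (W : ℝ) * G k := by
          refine Finset.sum_le_sum fun k _ => mul_le_mul_of_nonneg_right ?_ (hG0 k)
          have := card_shift_le S f k
          refine Nat.cast_le.2 (this.trans (Finset.card_le_card ?_))
          intro q
          simp only [Finset.mem_filter]
          exact fun h => ⟨h.1, abs_sub_lt_one_of_floor_eq h.2⟩
      _ ≤ _ := by
          rw [← Finset.mul_sum, mul_comm]
          gcongr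
          have := summable_three_div_one_add_sq.sum_le_tsum I (fun k _ => hG0 k)
          linarith
  calc _ ≤ K ^ 2 * ((1 + ∑' k : ℤ, G k) * W) := by gcongr
    _ = _ := by ring

/-! ### The Fourier series of the tent -/

/-- Fourier expansion of the tent function. -/
theorem hasSum_tent {w : ℝ} (hw : 0 < w) (hw2 : w ≤ 1 / 2) (t : ℝ) :
    HasSum (fun j : ℕ => 2 * (Real.sin (Real.pi * j * w) ^ 2 / (Real.pi ^ 2 * (j : ℝ) ^ 2)) *
      Real.cos (2 * Real.pi * j * t)) (max 0 (w - distNearestInt t) - w ^ 2) := by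
  set x := distNearestInt t with hx
  have hx0 : 0 ≤ x := abs_nonneg _
  have hx1 : x ≤ 1 / 2 := abs_sub_round t
  have hcos : ∀ j : ℕ, Real.cos (2 * Real.pi * j * t) = Real.cos (2 * Real.pi * j * x) := by
    intro j
    have h1 : Real.cos (2 * Real.pi * j * x) = Real.cos (2 * Real.pi * j * (t - round t)) := by
      rw [hx, distNearestInt]
      rcases abs_choice (t - round t) with h | h <;> rw [h]
      rw [mul_neg, Real.cos_neg]
    rw [h1, show 2 * Real.pi * j * (t - round t) =
      2 * Real.pi * j * t - ((j * round t : ℤ) : ℝ) * (2 * Real.pi) by push_cast; ring,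
      Real.cos_sub_int_mul_two_pi]
  have hB : ∀ y : ℝ, y ∈ Set.Icc (0 : ℝ) 1 →
      HasSum (fun n : ℕ => 1 / (n : ℝ) ^ 2 * Real.cos (2 * Real.pi * n * y))
        (Real.pi ^ 2 * (y ^ 2 - y + 6⁻¹)) := by
    intro y hy
    have h := hasSum_one_div_nat_pow_mul_cos one_ne_zero hy
    convert! h using 1
    have h2 := bernoulliFun_two y
    rw [bernoulliFun] at h2
    rw [mul_one, h2]
    rw [Nat.factorial_two]
    push_cast
    ring
  have e0 := hB x ⟨hx0, by linarith⟩
  have e1 := hB (x + w) ⟨by linarith, by linarith⟩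
  have e2 := hB |x - w| ⟨abs_nonneg _, abs_le.2 ⟨by linarith, by linarith⟩⟩
  -- The tent minus its mean is a second difference, with step `w`, of the periodic quadratic
  -- Bernoulli function: the quadratic parts leave `-w²` and the linear parts leave `max 0 (w - x)`.
  have e := ((e0.sub (e1.mul_left (1 / 2))).sub (e2.mul_left (1 / 2))).mul_left (1 / Real.pi ^ 2)
  have hpi : Real.pi ≠ 0 := Real.pi_ne_zero
  convert! e using 1
  · funext j
    have h2 : Real.cos (2 * Real.pi * j * |x - w|) = Real.cos (2 * Real.pi * j * (x - w)) := by
      rcases abs_choice (x - w) with h | h <;> rw [h]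
      rw [mul_neg, Real.cos_neg]
    rw [hcos, h2, mul_add (2 * Real.pi * j), mul_sub (2 * Real.pi * j), Real.cos_add,
      Real.cos_sub]
    have h3 : Real.cos (2 * Real.pi * j * w) = 1 - 2 * Real.sin (Real.pi * j * w) ^ 2 := by
      rw [show 2 * Real.pi * j * w = 2 * (Real.pi * j * w) by ring, Real.cos_two_mul,
        Real.cos_sq']
      ring
    rw [h3]
    rcases eq_or_ne (j : ℝ) 0 with h0 | h0
    · simp [h0]
    · field_simp
      ring
  · field_simp
    rcases le_total x w with h | h
    · rw [max_eq_right (by linarith), abs_of_nonpos (by linarith)]; ring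
    · rw [max_eq_left (by linarith), abs_of_nonneg (by linarith)]; ring

/-! ### Differences and the mean square of tent sums -/

/-- The ordered pairs `(n, m)` with `1 ≤ m < n ≤ N`. -/
def orderedPairs (N : ℕ) : Finset (ℕ × ℕ) :=
  (Finset.Icc 1 N ×ˢ Finset.Icc 1 N).filter fun p => p.2 < p.1

theorem card_orderedPairs_le (N : ℕ) : ((orderedPairs N).card : ℝ) ≤ (N : ℝ) ^ 2 := by
  have := Finset.card_filter_le (Finset.Icc 1 N ×ˢ Finset.Icc 1 N) fun p : ℕ × ℕ => p.2 < p.1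
  rw [Finset.card_product, Nat.card_Icc, Nat.add_sub_cancel, ← sq] at this
  exact_mod_cast this

theorem closePairs_le_approxEnergy (x : ℕ → ℝ) (N : ℕ) :
    closePairs (orderedPairs N) (fun p => x p.1 - x p.2) 1 ≤ approxEnergy x N 1 := by
  apply Finset.card_le_card_of_injOn
    (fun q : (ℕ × ℕ) × (ℕ × ℕ) => (q.1.1, q.1.2, q.2.2, q.2.1))
  · rintro ⟨⟨a, b⟩, c, d⟩ h
    simp only [Finset.coe_filter, Finset.mem_product, orderedPairs, Finset.mem_filter,
      Set.mem_ofPred_eq] at h ⊢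
    refine ⟨⟨h.1.1.1.1, h.1.1.1.2, h.1.2.1.2, h.1.2.1.1⟩, ?_⟩
    rw [show x a - x b + x d - x c = x a - x b - (x c - x d) by ring]
    exact h.2
  · rintro ⟨⟨a, b⟩, c, d⟩ _ ⟨⟨a', b'⟩, c', d'⟩ _ h
    simp only [Prod.mk.injEq] at h ⊢
    tauto

theorem le_sub_of_gap {x : ℕ → ℝ} {c : ℝ} (hc : 0 < c)
    (hgap : ∀ n : ℕ, 1 ≤ n → c ≤ x (n + 1) - x n) {N : ℕ} {p : ℕ × ℕ}
    (hp : p ∈ orderedPairs N) : c ≤ x p.1 - x p.2 := by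
  simp only [orderedPairs, Finset.mem_filter, Finset.mem_product, Finset.mem_Icc] at hp
  obtain ⟨⟨_, h2, _⟩, h⟩ := hp
  have key : ∀ n, p.2 + 1 ≤ n → c ≤ x n - x p.2 := by
    intro n hn
    induction n, hn using Nat.le_induction with
    | base => exact hgap _ h2
    | succ n hn ih => linarith [hgap n (by omega)]
  exact key _ h

/-- The Fourier coefficients of the tent function of height and half-width `w`. -/
noncomputable def tentCoeff (w : ℝ) (j : ℕ) : ℝ :=
  Real.sin (Real.pi * j * w) ^ 2 / (Real.pi ^ 2 * (j : ℝ) ^ 2)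

theorem tentCoeff_nonneg (w : ℝ) (j : ℕ) : 0 ≤ tentCoeff w j := by
  unfold tentCoeff; positivity

theorem tentCoeff_le_sq (w : ℝ) (j : ℕ) : tentCoeff w j ≤ w ^ 2 := by
  unfold tentCoeff
  apply div_le_of_le_mul₀ (by positivity) (by positivity)
  have := sq_le_sq.2 (Real.abs_sin_le_abs (x := Real.pi * j * w))
  nlinarith

theorem tentCoeff_le_inv_sq (w : ℝ) (j : ℕ) : tentCoeff w j ≤ 1 / (j : ℝ) ^ 2 := by
  unfold tentCoeff
  rcases Nat.eq_zero_or_pos j with rfl | hj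
  · simp
  have hj' : (0 : ℝ) < j := by exact_mod_cast hj
  apply div_le_div₀ zero_le_one (Real.sin_sq_le_one _) (by positivity)
  have := Real.pi_gt_three
  exact le_mul_of_one_le_left (by positivity) (by nlinarith)

/-- Partial sums over frequencies `a ≤ j < b` of the Fourier series of a sum of tents. -/
noncomputable def tentSum (D : Finset (ℕ × ℕ)) (z : ℕ × ℕ → ℝ) (w : ℝ) (a b : ℕ) (t : ℝ) : ℝ :=
  ∑ j ∈ Finset.Ico a b, tentCoeff w j * ∑ p ∈ D, Real.cos (2 * Real.pi * (j * z p) * t)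

theorem continuous_tentSum (D : Finset (ℕ × ℕ)) (z : ℕ × ℕ → ℝ) (w : ℝ) (a b : ℕ) :
    Continuous (tentSum D z w a b) := by
  unfold tentSum
  fun_prop

theorem abs_tentSum_le (D : Finset (ℕ × ℕ)) (z : ℕ × ℕ → ℝ) (w : ℝ) (a b : ℕ) (t : ℝ) :
    |tentSum D z w a b t| ≤ ∑ j ∈ Finset.Ico a b, tentCoeff w j * D.card := by
  unfold tentSum
  refine (Finset.abs_sum_le_sum_abs _ _).trans (Finset.sum_le_sum fun j _ => ?_)
  rw [abs_mul, abs_of_nonneg (tentCoeff_nonneg w j)]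
  refine mul_le_mul_of_nonneg_left ?_ (tentCoeff_nonneg w j)
  refine (Finset.abs_sum_le_sum_abs _ _).trans ?_
  refine (Finset.sum_le_sum fun p _ => Real.abs_cos_le_one _).trans ?_
  simp

theorem tentSum_eq_sum_dyadic (D : Finset (ℕ × ℕ)) (z : ℕ × ℕ → ℝ) (w : ℝ) (K : ℕ) (t : ℝ) :
    tentSum D z w 1 (2 ^ K) t =
      ∑ k ∈ Finset.range K, tentSum D z w (2 ^ k) (2 * 2 ^ k) t := by
  induction K with
  | zero => simp [tentSum]
  | succ K ih =>
    rw [Finset.sum_range_succ, ← ih, pow_succ, mul_comm _ 2]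
    unfold tentSum
    rw [Finset.sum_Ico_consecutive _ Nat.one_le_two_pow (by omega)]

open ProbabilityTheory in
theorem integrable_sq_tentSum (D : Finset (ℕ × ℕ)) (z : ℕ × ℕ → ℝ) (w : ℝ) (a b : ℕ) :
    Integrable (fun t => tentSum D z w a b t ^ 2) (gaussianReal 0 1) := by
  refine Integrable.of_bound
    (C := (∑ j ∈ Finset.Ico a b, tentCoeff w j * D.card) ^ 2)
    ((continuous_tentSum D z w a b).pow 2).aestronglyMeasurable (ae_of_all _ fun t => ?_)
  rw [norm_pow]
  exact pow_le_pow_left₀ (norm_nonneg _) (abs_tentSum_le D z w a b t) 2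

-- A block is a single cosine sum over pairs `(j, p)` with frequencies `j z p`, whose near
-- coincidences are what `dilateEnergy` counts.
open ProbabilityTheory in
theorem exists_integral_sq_tentSum_dyadic_le : ∃ C : ℝ, 0 < C ∧
    ∀ (D : Finset (ℕ × ℕ)) (z : ℕ × ℕ → ℝ) (w κ : ℝ) (A : ℕ), (∀ p ∈ D, 0 ≤ z p) →
      (∀ j ∈ Finset.Ico A (2 * A), tentCoeff w j ≤ κ) →
      ∫ t, tentSum D z w A (2 * A) t ^ 2 ∂(gaussianReal 0 1) ≤
        C * κ ^ 2 * dilateEnergy D z A := by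
  obtain ⟨C, hC, h⟩ := exists_integral_sq_cos_sum_le
  refine ⟨C, hC, fun D z w κ A hz hκ => ?_⟩
  have := h (Finset.Ico A (2 * A) ×ˢ D) (fun s => tentCoeff w s.1) (fun s => s.1 * z s.2) κ
    (fun s _ => tentCoeff_nonneg w _) (fun s hs => hκ _ (Finset.mem_product.1 hs).1)
    (fun s hs => mul_nonneg (by positivity) (hz _ (Finset.mem_product.1 hs).2))
  simpa only [Finset.sum_product, tentSum, Finset.mul_sum, dilateEnergy] using this

-- Cauchy–Schwarz over the dyadic blocks; the loss `K` is only logarithmic in the frequency cutoff.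
open ProbabilityTheory in
theorem integral_sq_tentSum_le_sum (D : Finset (ℕ × ℕ)) (z : ℕ × ℕ → ℝ) (w : ℝ) (K : ℕ) :
    ∫ t, tentSum D z w 1 (2 ^ K) t ^ 2 ∂(gaussianReal 0 1) ≤
      K * ∑ k ∈ Finset.range K,
        ∫ t, tentSum D z w (2 ^ k) (2 * 2 ^ k) t ^ 2 ∂(gaussianReal 0 1) := by
  rw [← integral_finsetSum _ fun k _ => integrable_sq_tentSum _ _ _ _ _, ← integral_const_mul]
  refine integral_mono (integrable_sq_tentSum _ _ _ _ _)
    ((integrable_finsetSum _ fun k _ => integrable_sq_tentSum _ _ _ _ _).const_mul _) fun t => ?_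
  simp only
  rw [tentSum_eq_sum_dyadic]
  simpa using sq_sum_le_card_mul_sum_sq (s := Finset.range K)
    (f := fun k => tentSum D z w (2 ^ k) (2 * 2 ^ k) t)

/-- Both bounds on `κ` combine to `S/m²` with `m = max n A`. Since `θ ≤ 4`, the power `m^(θ-4)` is
largest at `m = n`: the critical block is `A ≈ n`. -/
theorem sq_mul_rpow_le {κ S n A θ : ℝ} (hκ : 0 ≤ κ) (hn : 0 < n) (hA : 0 < A)
    (h1 : κ ≤ S / n ^ 2) (h2 : κ ≤ S / A ^ 2) (hθ0 : 0 ≤ θ) (hθ : θ ≤ 4) :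
    κ ^ 2 * A ^ θ ≤ S ^ 2 * n ^ (θ - 4) := by
  have key : ∀ m : ℝ, 0 < m → κ ≤ S / m ^ 2 → n ≤ m → A ≤ m →
      κ ^ 2 * A ^ θ ≤ S ^ 2 * n ^ (θ - 4) := by
    intro m hm h hnm hAm
    calc κ ^ 2 * A ^ θ ≤ (S / m ^ 2) ^ 2 * m ^ θ := by
          gcongr
      _ = S ^ 2 * m ^ (θ - 4) := by
          rw [Real.rpow_sub hm, show (4 : ℝ) = (4 : ℕ) by norm_num, Real.rpow_natCast]
          field_simp
      _ ≤ S ^ 2 * n ^ (θ - 4) := by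
          refine mul_le_mul_of_nonneg_left ?_ (sq_nonneg S)
          exact Real.rpow_le_rpow_of_nonpos hn hnm (by linarith)
  rcases le_total n A with h | h
  · exact key A hA h2 h le_rfl
  · exact key n hn h1 le_rfl h

-- Each block contributes at most a constant times `M N^{-δ}`, with `M` a divisor bound. The number
-- `K` of blocks enters twice, so the total loss `K² M ≤ M³` uses up half of the saving.
open ProbabilityTheory in
theorem exists_integral_sq_tentSum_le {c s C₁ δ : ℝ} (hc : 0 < c) (hC₁ : 0 ≤ C₁) (hδ : 0 < δ)
    (hδ4 : δ ≤ 1 / 4) :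
    ∃ C : ℝ, ∀ (N : ℕ) (D : Finset (ℕ × ℕ)) (z : ℕ × ℕ → ℝ), 1 ≤ N → (∀ p ∈ D, c ≤ z p) →
      (D.card : ℝ) ≤ (N : ℝ) ^ 2 →
      (closePairs D z 1 : ℝ) ≤ C₁ * (N : ℝ) ^ ((5 : ℝ) / 2 - δ) →
      ∫ t, tentSum D z (s / N) 1 (2 ^ (Nat.log 2 (N ^ 3) + 1)) t ^ 2 ∂(gaussianReal 0 1) ≤
        C * (N : ℝ) ^ (-(δ / 2)) := by
  obtain ⟨C₀, hC₀, hvar⟩ := exists_integral_sq_tentSum_dyadic_le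
  obtain ⟨C, hC⟩ := exists_nat_ge (1 + 24 / c)
  -- The divisor bound for integers up to `4N⁶`, cubed, costs `N^(18ε) = N^(δ/2)`.
  set ε : ℝ := δ / 36 with hε
  obtain ⟨Cd, hCd, hdiv⟩ := exists_card_divisors_le_rpow (ε := ε) (by positivity)
  set S : ℝ := 1 + s ^ 2 with hS
  set Q : ℝ := 10 * S ^ 2 * (Real.sqrt C₁ + 32 * C * C₁) with hQ
  have hQ0 : 0 ≤ Q := by positivity
  refine ⟨C₀ * Q * (Cd * 4 ^ ε) ^ 3, fun N D z hN hz hD hE => ?_⟩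
  have hN0 : (0 : ℝ) < N := by exact_mod_cast hN
  have hN1 : (1 : ℝ) ≤ N := by exact_mod_cast hN
  set E : ℝ := (closePairs D z 1 : ℝ) with hEdef
  set K := Nat.log 2 (N ^ 3) + 1 with hK
  set M := ⌊Cd * ((4 * N ^ 6 : ℕ) : ℝ) ^ ε⌋₊ with hM
  have hMdiv : ∀ u : ℕ, u ≠ 0 → u ≤ 4 * N ^ 6 → u.divisors.card ≤ M := by
    intro u hu0 hu
    apply Nat.le_floor
    refine (hdiv u hu0).trans ?_
    gcongr
  have h2K : 2 ^ (K - 1) ≤ N ^ 3 := by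
    rw [hK, Nat.add_sub_cancel]
    exact Nat.pow_log_le_self 2 (by positivity)
  have hKM : K ≤ M := by
    -- The number `2 ^ (K - 1)` has exactly `K` divisors, so the divisor bound also controls the
    -- logarithmic factor.
    have h1 := hMdiv (2 ^ (K - 1)) (by positivity) (h2K.trans (by
      have : N ^ 3 ≤ N ^ 6 := Nat.pow_le_pow_right hN (by norm_num)
      omega))
    rw [Nat.divisors_prime_pow Nat.prime_two, Finset.card_map, Finset.card_range] at h1
    omega
  have hM3 : (M : ℝ) ^ 3 ≤ (Cd * 4 ^ ε) ^ 3 * (N : ℝ) ^ (δ / 2) := by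
    have h1 : (M : ℝ) ≤ Cd * 4 ^ ε * (N : ℝ) ^ (δ / 6) := by
      refine (Nat.floor_le (by positivity)).trans (le_of_eq ?_)
      push_cast
      rw [Real.mul_rpow (by norm_num) (by positivity), ← Real.rpow_natCast,
        ← Real.rpow_mul hN0.le, mul_assoc, hε]
      congr 3
      push_cast; ring
    calc (M : ℝ) ^ 3 ≤ (Cd * 4 ^ ε * (N : ℝ) ^ (δ / 6)) ^ 3 := by gcongr
      _ = _ := by
        rw [mul_pow _ ((N : ℝ) ^ (δ / 6)), ← Real.rpow_natCast ((N : ℝ) ^ (δ / 6)),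
          ← Real.rpow_mul hN0.le]
        congr 2
        push_cast; ring
  have hterm : ∀ k ∈ Finset.range K,
      ∫ t, tentSum D z (s / N) (2 ^ k) (2 * 2 ^ k) t ^ 2 ∂(gaussianReal 0 1) ≤
        C₀ * (Q * M * (N : ℝ) ^ (-δ)) := by
    intro k hk
    set A := 2 ^ k with hA
    have hA0 : 0 < A := by positivity
    have hA0' : (0 : ℝ) < A := by exact_mod_cast hA0
    have hAN : A ≤ N ^ 3 := by
      refine le_trans (Nat.pow_le_pow_right two_pos ?_) h2K
      have := Finset.mem_range.1 hk
      omega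
    set κ : ℝ := min ((s / N) ^ 2) (1 / (A : ℝ) ^ 2) with hκ
    have hκ0 : 0 ≤ κ := by positivity
    have hκ1 : κ ≤ S / (N : ℝ) ^ 2 := by
      refine (min_le_left _ _).trans ?_
      rw [div_pow]
      gcongr
      linarith
    have hκ2 : κ ≤ S / (A : ℝ) ^ 2 := by
      refine (min_le_right _ _).trans ?_
      gcongr
      nlinarith [sq_nonneg s]
    have h1 := hvar D z (s / N) κ A (fun p hp => hc.le.trans (hz p hp)) (fun j hj => by
      rw [Finset.mem_Ico] at hj
      refine le_min (tentCoeff_le_sq _ _) ((tentCoeff_le_inv_sq _ _).trans ?_)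
      gcongr
      exact hj.1)
    have h2 := dilateEnergy_le D z hc hz hC hA0 (M := M) (by
      intro u hu
      rw [Finset.mem_Ico] at hu
      refine hMdiv u (by omega) (hu.2.le.trans ?_)
      calc 4 * A ^ 2 ≤ 4 * (N ^ 3) ^ 2 := by gcongr
        _ = 4 * N ^ 6 := by ring)
    refine h1.trans ?_
    rw [mul_assoc]
    refine mul_le_mul_of_nonneg_left ?_ hC₀.le
    rw [← hEdef] at h2
    have hE0 : 0 ≤ E := by positivity
    have p1 := sq_mul_rpow_le hκ0 hN0 hA0' hκ1 hκ2
      (θ := 1 / 2) (by norm_num) (by norm_num)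
    have p2 := sq_mul_rpow_le hκ0 hN0 hA0' hκ1 hκ2
      (θ := 3 / 2) (by norm_num) (by norm_num)
    have hA32 : (A : ℝ) ^ ((3 : ℝ) / 2) = A * Real.sqrt A := by
      rw [show (3 : ℝ) / 2 = 1 + 1 / 2 by norm_num, Real.rpow_add hA0', Real.rpow_one,
        Real.sqrt_eq_rpow]
    rw [← Real.sqrt_eq_rpow] at p1
    rw [hA32] at p2
    have q1 : Real.sqrt E ≤ Real.sqrt C₁ * (N : ℝ) ^ (5 / 4 - δ / 2) := by
      refine (Real.sqrt_le_sqrt hE).trans (le_of_eq ?_)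
      rw [Real.sqrt_mul hC₁, Real.sqrt_eq_rpow ((N : ℝ) ^ _), ← Real.rpow_mul hN0.le]
      congr 2
      ring
    -- The exponent on the left is `-1/4 - δ/2`; this is where an upper bound on `δ` is needed.
    have r1 : (N : ℝ) ^ ((1 : ℝ) / 2 - 4) * (N : ℝ) ^ 2 * (N : ℝ) ^ (5 / 4 - δ / 2) ≤
        (N : ℝ) ^ (-δ) := by
      rw [← Real.rpow_natCast, ← Real.rpow_add hN0, ← Real.rpow_add hN0]
      apply Real.rpow_le_rpow_of_exponent_le hN1
      push_cast
      linarith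
    have r2 : (N : ℝ) ^ ((3 : ℝ) / 2 - 4) * (N : ℝ) ^ (5 / 2 - δ) ≤ (N : ℝ) ^ (-δ) := by
      rw [← Real.rpow_add hN0]
      apply Real.rpow_le_rpow_of_exponent_le hN1
      linarith
    calc κ ^ 2 * (dilateEnergy D z A : ℝ)
        ≤ κ ^ 2 * (10 * M * Real.sqrt (A * E) * ((N : ℝ) ^ 2 + 32 * (C * A * Real.sqrt E))) := by
          gcongr
          exact h2.trans (by gcongr)
      _ = 10 * M * ((κ ^ 2 * Real.sqrt A) * (N : ℝ) ^ 2 * Real.sqrt E +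
          32 * C * ((κ ^ 2 * (A * Real.sqrt A)) * E)) := by
          rw [Real.sqrt_mul hA0'.le]
          have : Real.sqrt E * Real.sqrt E = E := Real.mul_self_sqrt hE0
          linear_combination (320 * M * κ ^ 2 * C * A * Real.sqrt A) * this
      _ ≤ 10 * M * ((S ^ 2 * (N : ℝ) ^ ((1 : ℝ) / 2 - 4)) * (N : ℝ) ^ 2 *
            (Real.sqrt C₁ * (N : ℝ) ^ (5 / 4 - δ / 2)) +
          32 * C * ((S ^ 2 * (N : ℝ) ^ ((3 : ℝ) / 2 - 4)) *
            (C₁ * (N : ℝ) ^ (5 / 2 - δ)))) := by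
          gcongr
      _ = 10 * M * S ^ 2 * (Real.sqrt C₁ *
            ((N : ℝ) ^ ((1 : ℝ) / 2 - 4) * (N : ℝ) ^ 2 * (N : ℝ) ^ (5 / 4 - δ / 2)) +
          32 * C * C₁ * ((N : ℝ) ^ ((3 : ℝ) / 2 - 4) * (N : ℝ) ^ (5 / 2 - δ))) := by ring
      _ ≤ 10 * M * S ^ 2 * (Real.sqrt C₁ * (N : ℝ) ^ (-δ) +
          32 * C * C₁ * (N : ℝ) ^ (-δ)) := by
          gcongr
      _ = _ := by rw [hQ]; ring
  calc _ ≤ (K : ℝ) * ∑ k ∈ Finset.range K,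
        ∫ t, tentSum D z (s / N) (2 ^ k) (2 * 2 ^ k) t ^ 2 ∂(gaussianReal 0 1) :=
        integral_sq_tentSum_le_sum D z _ K
    _ ≤ (K : ℝ) * ∑ k ∈ Finset.range K, C₀ * (Q * M * (N : ℝ) ^ (-δ)) := by
        gcongr with k hk
        exact hterm k hk
    _ = C₀ * Q * (N : ℝ) ^ (-δ) * ((K : ℝ) ^ 2 * M) := by
        rw [Finset.sum_const, Finset.card_range, nsmul_eq_mul]; ring
    _ ≤ C₀ * Q * (N : ℝ) ^ (-δ) * ((M : ℝ) ^ 2 * M) := by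
        gcongr
    _ = C₀ * Q * (N : ℝ) ^ (-δ) * (M : ℝ) ^ 3 := by ring
    _ ≤ C₀ * Q * (N : ℝ) ^ (-δ) * ((Cd * 4 ^ ε) ^ 3 * (N : ℝ) ^ (δ / 2)) := by gcongr
    _ = C₀ * Q * (Cd * 4 ^ ε) ^ 3 * ((N : ℝ) ^ (-δ) * (N : ℝ) ^ (δ / 2)) := by ring
    _ = _ := by
        rw [← Real.rpow_add hN0]
        congr 2
        ring

/-! ### From tents to pair counts -/

theorem distNearestInt_neg (t : ℝ) : distNearestInt (-t) = distNearestInt t := by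
  apply le_antisymm <;> unfold distNearestInt
  · refine (round_le (-t) (-round t)).trans (le_of_eq ?_)
    push_cast
    rw [← abs_neg]
    ring_nf
  · refine (round_le t (-round (-t))).trans (le_of_eq ?_)
    push_cast
    rw [← abs_neg]
    ring_nf

theorem card_filter_ne_eq_two_mul (N : ℕ) (P : ℕ × ℕ → Prop) [DecidablePred P]
    (hP : ∀ p, P p.swap ↔ P p) :
    ((Finset.Icc 1 N ×ˢ Finset.Icc 1 N).filter fun p => p.1 ≠ p.2 ∧ P p).card =
      2 * ((orderedPairs N).filter P).card := by
  have h1 : ((Finset.Icc 1 N ×ˢ Finset.Icc 1 N).filter fun p => p.1 ≠ p.2 ∧ P p) =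
      (orderedPairs N).filter P ∪ ((orderedPairs N).filter P).map ⟨Prod.swap, Prod.swap_injective⟩ := by
    ext ⟨a, b⟩
    simp only [Finset.mem_filter, Finset.mem_product, Finset.mem_union, Finset.mem_map,
      Function.Embedding.coeFn_mk, orderedPairs, Finset.mem_Icc]
    constructor
    · rintro ⟨⟨ha, hb⟩, hne, h⟩
      rcases lt_or_gt_of_ne hne with hlt | hlt
      · right; exact ⟨(b, a), ⟨⟨⟨hb, ha⟩, hlt⟩, (hP (a, b)).2 h⟩, rfl⟩
      · left; exact ⟨⟨⟨ha, hb⟩, hlt⟩, h⟩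
    · rintro (⟨⟨⟨ha, hb⟩, hlt⟩, h⟩ | ⟨⟨a', b'⟩, ⟨⟨⟨ha, hb⟩, hlt⟩, h⟩, he⟩)
      · exact ⟨⟨ha, hb⟩, hlt.ne', h⟩
      · simp only [Prod.swap_prod_mk, Prod.mk.injEq] at he
        obtain ⟨rfl, rfl⟩ := he
        exact ⟨⟨hb, ha⟩, hlt.ne, (hP (a', b')).2 h⟩
  rw [h1, Finset.card_union_of_disjoint, Finset.card_map, two_mul]
  rw [Finset.disjoint_left]
  rintro ⟨a, b⟩ h h'
  simp only [Finset.mem_filter, Finset.mem_map, Function.Embedding.coeFn_mk, orderedPairs] at h h'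
  obtain ⟨⟨a', b'⟩, ⟨⟨_, h2⟩, _⟩, he⟩ := h'
  simp only [Prod.swap_prod_mk, Prod.mk.injEq] at he
  obtain ⟨rfl, rfl⟩ := he
  exact lt_asymm h2 h.1.2

theorem two_mul_card_orderedPairs (N : ℕ) : 2 * ((orderedPairs N).card : ℝ) = (N : ℝ) ^ 2 - N := by
  have h := card_filter_ne_eq_two_mul N (fun _ => True) (fun _ => Iff.rfl)
  simp only [and_true, Finset.filter_true] at h
  have h2 : (Finset.Icc 1 N ×ˢ Finset.Icc 1 N).filter (fun p => p.1 ≠ p.2) =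
      (Finset.Icc 1 N).offDiag := by
    ext p
    simp only [Finset.mem_filter, Finset.mem_product, Finset.mem_offDiag, and_assoc]
  rw [h2, Finset.offDiag_card, Nat.card_Icc, Nat.add_sub_cancel] at h
  have h3 : ((N * N - N : ℕ) : ℝ) = (N : ℝ) ^ 2 - N := by
    rw [Nat.cast_sub (Nat.le_mul_self N)]; push_cast; ring
  rw [← h3, h]; push_cast; ring

theorem pairCount_eq_two_mul (y : ℕ → ℝ) (s : ℝ) (N : ℕ) :
    pairCount y s N = 2 * ((orderedPairs N).filter
      fun p => distNearestInt (y p.1 - y p.2) ≤ s / (N : ℝ)).card := by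
  rw [pairCount, card_filter_ne_eq_two_mul]
  intro p
  simp only [Prod.fst_swap, Prod.snd_swap]
  rw [← distNearestInt_neg, neg_sub]

theorem pairCount_mono {y : ℕ → ℝ} {s t : ℝ} {N M : ℕ} (hNM : N ≤ M) (h : s / N ≤ t / M) :
    pairCount y s N ≤ pairCount y t M := by
  apply Finset.card_le_card
  intro p
  simp only [Finset.mem_filter, Finset.mem_product, Finset.mem_Icc]
  rintro ⟨⟨⟨a1, a2⟩, b1, b2⟩, h1, h2⟩
  exact ⟨⟨⟨a1, a2.trans hNM⟩, b1, b2.trans hNM⟩, h1, h2.trans h⟩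

/-- Pair correlation sum with a tent instead of an indicator function. -/
noncomputable def hatSum (y : ℕ → ℝ) (s : ℝ) (N : ℕ) : ℝ :=
  2 * ∑ p ∈ orderedPairs N, max 0 (s / N - distNearestInt (y p.1 - y p.2))

/-- The difference of the tents of half-widths `t/N` and `s/N` equals `(t - s)/N` at distances up to
`s/N` and is nonnegative everywhere. -/
theorem pairCount_mul_le (y : ℕ → ℝ) {s t : ℝ} (hst : s ≤ t) (N : ℕ) :
    (1 / (N : ℝ) * pairCount y s N) * (t - s) ≤ hatSum y t N - hatSum y s N := by
  rw [pairCount_eq_two_mul, hatSum, hatSum, ← mul_sub, ← Finset.sum_sub_distrib,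
    Finset.card_filter]
  push_cast
  rw [show ∀ a b c : ℝ, a * (2 * b) * c = 2 * (b * (c * a)) by intros; ring, Finset.sum_mul]
  refine mul_le_mul_of_nonneg_left (Finset.sum_le_sum fun p _ => ?_) zero_le_two
  generalize distNearestInt (y p.1 - y p.2) = d
  have h0 : s / N ≤ t / N := by gcongr
  split_ifs with h
  · rw [max_eq_right (by linarith), max_eq_right (by linarith)]
    apply le_of_eq; ring
  · rw [zero_mul, sub_nonneg]
    exact max_le_max le_rfl (by linarith)

/-- The difference of the two tents never exceeds `(t - s)/N` and vanishes at distances beyond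
`t/N`. -/
theorem le_pairCount_mul (y : ℕ → ℝ) {s t : ℝ} (hst : s ≤ t) (N : ℕ) :
    hatSum y t N - hatSum y s N ≤ (1 / (N : ℝ) * pairCount y t N) * (t - s) := by
  rw [pairCount_eq_two_mul, hatSum, hatSum, ← mul_sub, ← Finset.sum_sub_distrib,
    Finset.card_filter]
  push_cast
  rw [show ∀ a b c : ℝ, a * (2 * b) * c = 2 * (b * (c * a)) by intros; ring, Finset.sum_mul]
  refine mul_le_mul_of_nonneg_left (Finset.sum_le_sum fun p _ => ?_) zero_le_two
  generalize distNearestInt (y p.1 - y p.2) = d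
  have h0 : s / N ≤ t / N := by gcongr
  split_ifs with h
  · rw [max_eq_right (by linarith)]
    have := le_max_right 0 (s / N - d)
    rw [one_mul, mul_one_div, sub_div]
    linarith
  · rw [max_eq_left (by linarith), max_eq_left (by linarith)]
    simp

/-! ### Interpolation between consecutive powers -/

theorem exists_root_index (p : ℕ) (hp : p ≠ 0) : ∃ κ : ℕ → ℕ, Tendsto κ atTop atTop ∧
    ∀ N, 1 ≤ N → (κ N + 1) ^ p ≤ N ∧ N ≤ (κ N + 2) ^ p := by
  refine ⟨fun N => Nat.findGreatest (fun k => (k + 1) ^ p ≤ N) N, ?_, fun N hN => ⟨?_, ?_⟩⟩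
  · rw [tendsto_atTop]
    intro b
    filter_upwards [eventually_ge_atTop ((b + 1) ^ p)] with N hN
    refine Nat.le_findGreatest ?_ hN
    calc b ≤ b + 1 := by omega
      _ ≤ (b + 1) ^ p := Nat.le_self_pow hp _
      _ ≤ N := hN
  · exact Nat.findGreatest_spec (P := fun k => (k + 1) ^ p ≤ N) (Nat.zero_le N) (by simpa using hN)
  · set k := Nat.findGreatest (fun k => (k + 1) ^ p ≤ N) N with hk
    by_cases h : k + 1 ≤ N
    · have := Nat.findGreatest_is_greatest (P := fun k => (k + 1) ^ p ≤ N)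
        (n := N) (k := k + 1) (by omega) h
      exact (not_le.1 this).le
    · calc N ≤ k + 2 := by omega
        _ ≤ _ := Nat.le_self_pow hp _

theorem tendsto_root_ratio {p : ℕ} {κ : ℕ → ℕ} (hκ : Tendsto κ atTop atTop) :
    Tendsto (fun N => (((κ N + 2) ^ p : ℕ) : ℝ) / ((κ N + 1) ^ p : ℕ)) atTop (nhds 1) := by
  have h1 : Tendsto (fun k : ℕ => (((k : ℝ) + 1 + 1) / (k + 1)) ^ p) atTop (nhds 1) := by
    have h2 : Tendsto (fun k : ℕ => 1 + 1 / ((k : ℝ) + 1)) atTop (nhds (1 + 0)) :=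
      tendsto_const_nhds.add tendsto_one_div_add_atTop_nhds_zero_nat
    have h3 := h2.pow p
    rw [add_zero, one_pow] at h3
    refine h3.congr fun k => ?_
    have : (k : ℝ) + 1 ≠ 0 := by positivity
    congr 1
    field_simp
  refine (h1.comp hκ).congr fun N => ?_
  simp only [Function.comp]
  push_cast
  rw [← div_pow]
  congr 2
  ring

/-- Convergence of the tent sums along `(k + 1) ^ p` gives Poissonian pair correlation. -/
theorem hasPoissonianPairCorrelation_of_hatSum {y : ℕ → ℝ} {p : ℕ} (hp : p ≠ 0)
    (h : ∀ q : ℚ, 0 < q →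
      Tendsto (fun k : ℕ => hatSum y q ((k + 1) ^ p)) atTop (nhds ((q : ℝ) ^ 2))) :
    HasPoissonianPairCorrelation y := by
  intro s hs
  obtain ⟨κ, hκ, hκN⟩ := exists_root_index p hp
  set L : ℕ → ℕ := fun N => (κ N + 1) ^ p with hL
  set U : ℕ → ℕ := fun N => (κ N + 2) ^ p with hU
  have hL0 : ∀ N, 0 < (L N : ℝ) := fun N => by simp only [hL]; positivity
  have hU0 : ∀ N, 0 < (U N : ℝ) := fun N => by simp only [hU]; positivity
  have hratio : Tendsto (fun N => (U N : ℝ) / L N) atTop (nhds 1) := tendsto_root_ratio hκ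
  have hratio' : Tendsto (fun N => (L N : ℝ) / U N) atTop (nhds 1) := by
    have := hratio.inv₀ one_ne_zero
    rw [inv_one] at this
    exact this.congr fun N => inv_div _ _
  -- Difference quotients of the limit `q²` give `q + r`, which approaches `2s` as `q` and `r`
  -- approach `s`.
  have hquot : ∀ q r : ℚ, 0 < q → q < r →
      Tendsto (fun k : ℕ => (hatSum y r ((k + 1) ^ p) - hatSum y q ((k + 1) ^ p)) / (r - q : ℝ))
        atTop (nhds (q + r : ℝ)) := by
    intro q r hq hqr
    have h1 := ((h r (hq.trans hqr)).sub (h q hq)).div_const (r - q : ℝ)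
    have : ((r : ℝ) ^ 2 - (q : ℝ) ^ 2) / (r - q) = q + r := by
      have : (r : ℝ) - q ≠ 0 := sub_ne_zero.2 (by exact_mod_cast hqr.ne')
      field_simp
      ring
    rwa [this] at h1
  rw [tendsto_order]
  constructor
  · intro a ha
    -- Choose rationals `max (a/2) 0 < q < r < s`. As `U/L → 1` and `r < s`, eventually `r/L ≤ s/N`,
    -- so the count at `L N` bounds the count at `N` from below.
    obtain ⟨b, hb1, hb2⟩ := exists_between (max_lt (by linarith : a / 2 < s) hs)
    obtain ⟨q, hq1, hq2⟩ := exists_rat_btwn hb1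
    obtain ⟨r, hr1, hr2⟩ := exists_rat_btwn (hq2.trans hb2)
    have hqa : a / 2 < q := (le_max_left _ _).trans_lt hq1
    have hq0 : (0 : ℚ) < q := by exact_mod_cast (le_max_right (a / 2) 0).trans_lt hq1
    have hqr : q < r := by exact_mod_cast hr1
    have hlim := hratio'.mul ((hquot q r hq0 hqr).comp hκ)
    rw [one_mul] at hlim
    have e1 := hlim.eventually (lt_mem_nhds (show a < q + r by linarith))
    have e2 := (hratio'.const_mul s).eventually (lt_mem_nhds (show (r : ℝ) < s * 1 by linarith))
    filter_upwards [e1, e2, eventually_ge_atTop 1] with N e1 e2 hN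
    refine e1.trans_le ?_
    obtain ⟨hLN, hNU⟩ := hκN N hN
    have hN0 : (0 : ℝ) < N := by exact_mod_cast hN
    have hLN' : (L N : ℝ) ≤ N := by exact_mod_cast hLN
    have hNU' : (N : ℝ) ≤ U N := by exact_mod_cast hNU
    have hrq : (0 : ℝ) < r - q := by linarith
    have h1 : (hatSum y r (L N) - hatSum y q (L N)) / (r - q : ℝ) ≤
        1 / (L N : ℝ) * pairCount y r (L N) := by
      rw [div_le_iff₀ hrq]
      exact le_pairCount_mul y (by linarith) _
    have h2 : pairCount y r (L N) ≤ pairCount y s N := by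
      refine pairCount_mono hLN ?_
      rw [div_le_div_iff₀ (hL0 N) hN0]
      have : (r : ℝ) < s * (L N) / U N := by rw [mul_div_assoc]; exact e2
      rw [lt_div_iff₀ (hU0 N)] at this
      have hr0 : (0 : ℝ) ≤ r := by exact_mod_cast (hq0.trans hqr).le
      nlinarith
    calc (L N : ℝ) / U N * ((hatSum y r (L N) - hatSum y q (L N)) / (r - q : ℝ))
        ≤ (L N : ℝ) / U N * (1 / (L N : ℝ) * pairCount y r (L N)) := by gcongr
      _ = 1 / (U N : ℝ) * pairCount y r (L N) := by
        have := (hL0 N).ne'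
        field_simp
      _ ≤ 1 / (N : ℝ) * pairCount y s N := by gcongr
  · intro a ha
    obtain ⟨b, hb1, hb2⟩ := exists_between (by linarith : s < a / 2)
    obtain ⟨q, hq1, hq2⟩ := exists_rat_btwn hb1
    obtain ⟨r, hr1, hr2⟩ := exists_rat_btwn (hq2.trans hb2)
    have hq0 : (0 : ℚ) < q := by exact_mod_cast hs.trans hq1
    have hqr : q < r := by exact_mod_cast hr1
    -- For the upper bound the limit is taken along `U N = ((κ N + 1) + 1) ^ p`, hence the index
    -- shift.
    have hκ' : Tendsto (fun N => κ N + 1) atTop atTop :=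
      tendsto_atTop_mono (fun N => Nat.le_succ _) hκ
    have hlim := hratio.mul ((hquot q r hq0 hqr).comp hκ')
    rw [one_mul] at hlim
    have e1 := hlim.eventually (gt_mem_nhds (show (q + r : ℝ) < a by linarith))
    have e2 := (hratio.const_mul s).eventually (gt_mem_nhds (show s * 1 < (q : ℝ) by linarith))
    filter_upwards [e1, e2, eventually_ge_atTop 1] with N e1 e2 hN
    refine lt_of_le_of_lt ?_ e1
    obtain ⟨hLN, hNU⟩ := hκN N hN
    have hN0 : (0 : ℝ) < N := by exact_mod_cast hN
    have hLN' : (L N : ℝ) ≤ N := by exact_mod_cast hLN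
    have hNU' : (N : ℝ) ≤ U N := by exact_mod_cast hNU
    have hrq : (0 : ℝ) < r - q := by linarith
    have h1 : 1 / (U N : ℝ) * pairCount y q (U N) ≤
        (hatSum y r (U N) - hatSum y q (U N)) / (r - q : ℝ) := by
      rw [le_div_iff₀ hrq]
      exact pairCount_mul_le y (by linarith) _
    have h2 : pairCount y s N ≤ pairCount y q (U N) := by
      refine pairCount_mono hNU ?_
      rw [div_le_div_iff₀ hN0 (hU0 N)]
      have : s * (U N) / L N < (q : ℝ) := by rw [mul_div_assoc]; exact e2
      rw [div_lt_iff₀ (hL0 N)] at this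
      have hq0' : (0 : ℝ) ≤ q := by exact_mod_cast hq0.le
      nlinarith
    calc 1 / (N : ℝ) * pairCount y s N ≤ 1 / (L N : ℝ) * pairCount y q (U N) := by
          have := hL0 N
          gcongr
      _ = (U N : ℝ) / L N * (1 / (U N : ℝ) * pairCount y q (U N)) := by
        have := (hU0 N).ne'
        field_simp
      _ ≤ (U N : ℝ) / L N * ((hatSum y r (U N) - hatSum y q (U N)) / (r - q : ℝ)) := by
        gcongr

/-! ### Truncation of the Fourier series -/

theorem abs_tent_sub_partial_le {w : ℝ} (hw : 0 < w) (hw2 : w ≤ 1 / 2) (t : ℝ) {J : ℕ}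
    (hJ : 1 ≤ J) :
    |max 0 (w - distNearestInt t) - w ^ 2 -
      ∑ j ∈ Finset.Ico 1 J, 2 * tentCoeff w j * Real.cos (2 * Real.pi * j * t)| ≤ 4 / J := by
  set F : ℕ → ℝ := fun j => 2 * tentCoeff w j * Real.cos (2 * Real.pi * j * t) with hF
  have hF0 : F 0 = 0 := by simp [hF, tentCoeff]
  have hlim := ((hasSum_tent hw hw2 t).tendsto_sum_nat.sub_const
    (∑ j ∈ Finset.Ico 1 J, F j)).abs
  refine le_of_tendsto hlim ?_
  filter_upwards [eventually_ge_atTop J] with n hn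
  have h1 : ∑ j ∈ Finset.range n, F j = ∑ j ∈ Finset.Ico 1 n, F j := by
    rw [Finset.range_eq_Ico, Finset.sum_eq_sum_Ico_succ_bot (by omega), hF0, zero_add]
  have h2 : ∑ j ∈ Finset.range n, F j - ∑ j ∈ Finset.Ico 1 J, F j = ∑ j ∈ Finset.Ico J n, F j := by
    rw [h1, ← Finset.sum_Ico_consecutive F hJ hn]; ring
  calc |∑ j ∈ Finset.range n, F j - ∑ j ∈ Finset.Ico 1 J, F j|
      = |∑ j ∈ Finset.Ico J n, F j| := by rw [h2]
    _ ≤ ∑ j ∈ Finset.Ico J n, 2 * ((j : ℝ) ^ 2)⁻¹ := by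
        refine (Finset.abs_sum_le_sum_abs _ _).trans (Finset.sum_le_sum fun j _ => ?_)
        have h0 := tentCoeff_nonneg w j
        have h1 := tentCoeff_le_inv_sq w j
        simp only [hF]
        rw [abs_mul, abs_of_nonneg (by positivity), ← one_div]
        calc 2 * tentCoeff w j * |Real.cos (2 * Real.pi * j * t)| ≤ 2 * tentCoeff w j * 1 := by
              gcongr; exact Real.abs_cos_le_one _
          _ ≤ _ := by linarith
    _ = 2 * ∑ j ∈ Finset.Ioo (J - 1) n, ((j : ℝ) ^ 2)⁻¹ := by
        rw [Finset.mul_sum]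
        refine Finset.sum_congr ?_ fun _ _ => rfl
        ext j
        simp only [Finset.mem_Ico, Finset.mem_Ioo]
        omega
    _ ≤ 2 * (2 / (((J - 1 : ℕ) : ℝ) + 1)) := by
        gcongr
        exact sum_Ioo_inv_sq_le _ _
    _ = 4 / J := by
        rw [Nat.cast_sub hJ, Nat.cast_one, sub_add_cancel]; ring

/-- The means `(s/N)²` over the `N² - N` pairs add up to `s²(1 - 1/N)`. Truncating at `J ≥ N³` costs
`4/J` per pair, thus `O(1/N)` in total. The factor 4 is 2 for the order of a pair times 2 from the
cosine series. -/
theorem abs_hatSum_sub_le (x : ℕ → ℝ) {s : ℝ} {N J : ℕ} (hN : 1 ≤ N) (hs : 0 < s)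
    (hsN : 2 * s ≤ N) (hJ : N ^ 3 ≤ J) (t : ℝ) :
    |hatSum (fun n => t * x n) s N - s ^ 2 * (1 - 1 / N) -
      4 * tentSum (orderedPairs N) (fun p => x p.1 - x p.2) (s / N) 1 J t| ≤ 8 / (N : ℝ) := by
  have hN0 : (0 : ℝ) < N := by exact_mod_cast hN
  have hJ1 : 1 ≤ J := le_trans (Nat.one_le_pow _ _ hN) hJ
  have hJ' : (N : ℝ) ^ 3 ≤ J := by exact_mod_cast hJ
  have hw : 0 < s / N := by positivity
  have hw2 : s / N ≤ 1 / 2 := by rw [div_le_div_iff₀ hN0 two_pos]; linarith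
  have e1 : s ^ 2 * (1 - 1 / (N : ℝ)) = 2 * ∑ p ∈ orderedPairs N, (s / N) ^ 2 := by
    rw [Finset.sum_const, nsmul_eq_mul, ← mul_assoc, two_mul_card_orderedPairs]
    field_simp
  have e2 : 4 * tentSum (orderedPairs N) (fun p => x p.1 - x p.2) (s / N) 1 J t =
      2 * ∑ p ∈ orderedPairs N, ∑ j ∈ Finset.Ico 1 J,
        2 * tentCoeff (s / N) j * Real.cos (2 * Real.pi * j * (t * x p.1 - t * x p.2)) := by
    rw [tentSum, Finset.sum_comm, Finset.mul_sum, Finset.mul_sum]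
    refine Finset.sum_congr rfl fun j _ => ?_
    rw [Finset.mul_sum, Finset.mul_sum, Finset.mul_sum]
    refine Finset.sum_congr rfl fun p _ => ?_
    rw [show 2 * Real.pi * (j * (x p.1 - x p.2)) * t =
      2 * Real.pi * j * (t * x p.1 - t * x p.2) by ring]
    ring
  have e3 : hatSum (fun n => t * x n) s N - s ^ 2 * (1 - 1 / N) -
      4 * tentSum (orderedPairs N) (fun p => x p.1 - x p.2) (s / N) 1 J t =
      2 * ∑ p ∈ orderedPairs N, (max 0 (s / N - distNearestInt (t * x p.1 - t * x p.2)) -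
        (s / N) ^ 2 - ∑ j ∈ Finset.Ico 1 J,
          2 * tentCoeff (s / N) j * Real.cos (2 * Real.pi * j * (t * x p.1 - t * x p.2))) := by
    rw [e1, e2, hatSum, Finset.sum_sub_distrib, Finset.sum_sub_distrib]
    ring
  rw [e3, abs_mul, abs_two]
  calc _ ≤ 2 * ∑ p ∈ orderedPairs N, (4 / (J : ℝ)) := by
        gcongr
        exact (Finset.abs_sum_le_sum_abs _ _).trans
          (Finset.sum_le_sum fun p _ => abs_tent_sub_partial_le hw hw2 _ hJ1)
    _ = 2 * ((orderedPairs N).card * (4 / (J : ℝ))) := by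
        rw [Finset.sum_const, nsmul_eq_mul]
    _ ≤ 2 * ((N : ℝ) ^ 2 * (4 / (N : ℝ) ^ 3)) := by
        gcongr
        exact card_orderedPairs_le N
    _ = 8 / N := by field_simp; norm_num

/-! ### Almost sure convergence and conclusion -/

/-- Functions with summable mean squares tend to zero almost everywhere. -/
theorem ae_tendsto_zero_of_summable_integral_sq {Ω : Type*} [MeasurableSpace Ω] {μ : Measure Ω}
    {f : ℕ → Ω → ℝ} (hint : ∀ k, Integrable (fun t => f k t ^ 2) μ)
    (hsum : Summable fun k => ∫ t, f k t ^ 2 ∂μ) :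
    ∀ᵐ t ∂μ, Tendsto (fun k => f k t) atTop (nhds 0) := by
  have h1 : ∀ k, ∫⁻ t, ENNReal.ofReal (f k t ^ 2) ∂μ = ENNReal.ofReal (∫ t, f k t ^ 2 ∂μ) :=
    fun k => (ofReal_integral_eq_lintegral_ofReal (hint k)
      (ae_of_all _ fun t => sq_nonneg _)).symm
  have hmeas : ∀ k, AEMeasurable (fun t => ENNReal.ofReal (f k t ^ 2)) μ := fun k =>
    (hint k).aestronglyMeasurable.aemeasurable.ennreal_ofReal
  have h2 : ∫⁻ t, ∑' k, ENNReal.ofReal (f k t ^ 2) ∂μ ≠ ⊤ := by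
    rw [lintegral_tsum hmeas]
    simp_rw [h1]
    exact hsum.tsum_ofReal_ne_top
  filter_upwards [ae_lt_top' (AEMeasurable.tsum hmeas) h2] with t ht
  have h3 := ENNReal.tendsto_atTop_zero_of_tsum_ne_top ht.ne
  have h4 : Tendsto (fun k => f k t ^ 2) atTop (nhds 0) := by
    have := (ENNReal.tendsto_toReal ENNReal.zero_ne_top).comp h3
    refine this.congr fun k => ?_
    simp [ENNReal.toReal_ofReal (sq_nonneg (f k t))]
  have h5 := (Real.continuous_sqrt.tendsto 0).comp h4
  rw [Real.sqrt_zero] at h5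
  refine (tendsto_zero_iff_abs_tendsto_zero _).2 (h5.congr fun k => ?_)
  simp [Real.sqrt_sq_eq_abs]

-- Along `N = (k+1)^p` the mean squares are `O(N^{-δ/2})`, hence `O((k+1)^{-2})` because `p δ ≥ 4`,
-- and so summable.
open ProbabilityTheory in
theorem ae_tendsto_hatSum {x : ℕ → ℝ} {c : ℝ} (hc : 0 < c)
    (hgap : ∀ n : ℕ, 1 ≤ n → c ≤ x (n + 1) - x n) {δ C₁ : ℝ} (hδ : 0 < δ) (hδ4 : δ ≤ 1 / 4)
    (hC₁ : 0 ≤ C₁)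
    (hE : ∀ᶠ N : ℕ in atTop, (approxEnergy x N 1 : ℝ) ≤ C₁ * (N : ℝ) ^ ((5 : ℝ) / 2 - δ))
    {p : ℕ} (hp : 4 ≤ p * δ) {s : ℝ} (hs : 0 < s) :
    ∀ᵐ t : ℝ, Tendsto (fun k : ℕ => hatSum (fun n => t * x n) s ((k + 1) ^ p)) atTop
      (nhds (s ^ 2)) := by
  have hp0 : p ≠ 0 := by rintro rfl; norm_num at hp
  obtain ⟨C, hC⟩ := exists_integral_sq_tentSum_le (s := s) hc hC₁ hδ hδ4
  set ν : ℕ → ℕ := fun k => (k + 1) ^ p with hν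
  have hν1 : ∀ k, 1 ≤ ν k := fun k => Nat.one_le_pow _ _ (Nat.succ_pos k)
  have hνtop : Tendsto ν atTop atTop :=
    (tendsto_pow_atTop hp0).comp (tendsto_add_atTop_nat 1)
  set f : ℕ → ℝ → ℝ := fun k => tentSum (orderedPairs (ν k)) (fun q => x q.1 - x q.2)
    (s / ν k) 1 (2 ^ (Nat.log 2 (ν k ^ 3) + 1)) with hf
  have hsum : Summable fun k => ∫ t, f k t ^ 2 ∂(gaussianReal 0 1) := by
    have hb : Summable fun k : ℕ => C * (1 / ((k + 1 : ℕ) : ℝ) ^ 2) :=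
      ((summable_nat_add_iff 1).2 (Real.summable_one_div_nat_pow.2 one_lt_two)).mul_left C
    refine Summable.of_norm_bounded_eventually_nat hb ?_
    filter_upwards [hνtop.eventually hE] with k hk
    rw [Real.norm_of_nonneg (integral_nonneg fun t => sq_nonneg _)]
    have h1 := hC (ν k) (orderedPairs (ν k)) (fun q => x q.1 - x q.2) (hν1 k)
      (fun q hq => le_sub_of_gap hc hgap hq) (card_orderedPairs_le _)
      (le_trans (by exact_mod_cast closePairs_le_approxEnergy x (ν k)) hk)
    refine h1.trans ?_
    have hC0 : 0 ≤ C := by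
      have h0 : 0 ≤ C * (ν k : ℝ) ^ (-(δ / 2)) :=
        (integral_nonneg fun t => sq_nonneg _).trans h1
      have : 0 < (ν k : ℝ) ^ (-(δ / 2)) :=
        Real.rpow_pos_of_pos (by exact_mod_cast hν1 k) _
      exact nonneg_of_mul_nonneg_left h0 this
    refine mul_le_mul_of_nonneg_left ?_ hC0
    have hk1 : (1 : ℝ) ≤ ((k + 1 : ℕ) : ℝ) := by exact_mod_cast Nat.succ_pos k
    have hk0 : (0 : ℝ) ≤ ((k + 1 : ℕ) : ℝ) := by positivity
    simp only [hν]
    rw [Nat.cast_pow, ← Real.rpow_natCast, ← Real.rpow_mul hk0, one_div,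
      ← Real.rpow_natCast _ 2, ← Real.rpow_neg hk0]
    apply Real.rpow_le_rpow_of_exponent_le hk1
    push_cast
    linarith
  have hae := ae_tendsto_zero_of_summable_integral_sq
    (fun k => integrable_sq_tentSum _ _ _ _ _) hsum
  -- Lebesgue measure is absolutely continuous with respect to the Gaussian, so the exceptional set
  -- is Lebesgue null.
  have hae' := (gaussianReal_absolutelyContinuous' 0 one_ne_zero).ae_le hae
  filter_upwards [hae'] with t ht
  have hνR : Tendsto (fun k => (ν k : ℝ)) atTop atTop := tendsto_natCast_atTop_atTop.comp hνtop
  have hinv : Tendsto (fun k => 1 / (ν k : ℝ)) atTop (nhds 0) := by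
    simp_rw [one_div]
    exact hνR.inv_tendsto_atTop
  have h8 : Tendsto (fun k => 8 / (ν k : ℝ)) atTop (nhds 0) := by
    simpa only [mul_one_div, mul_zero] using hinv.const_mul 8
  have herr : Tendsto (fun k => hatSum (fun n => t * x n) s (ν k) -
      s ^ 2 * (1 - 1 / (ν k : ℝ)) - 4 * f k t) atTop (nhds 0) := by
    refine squeeze_zero_norm' ?_ h8
    filter_upwards [hνR.eventually_ge_atTop (2 * s)] with k hk
    exact abs_hatSum_sub_le x (hν1 k) hs hk (Nat.lt_pow_succ_log_self one_lt_two _).le t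
  have h1 := (herr.add ((tendsto_const_nhds (x := (1 : ℝ))).sub hinv |>.const_mul (s ^ 2))).add
    (ht.const_mul 4)
  rw [show (0 : ℝ) + s ^ 2 * (1 - 0) + 4 * 0 = s ^ 2 by ring] at h1
  refine h1.congr fun k => ?_
  ring

theorem mainTheorem3 (x : ℕ → ℝ) (hpos : ∀ n : ℕ, 1 ≤ n → 0 < x n)
    (c : ℝ) (hc : 0 < c) (hgap : ∀ n : ℕ, 1 ≤ n → c ≤ x (n + 1) - x n)
    (δ : ℝ) (hδ : 0 < δ)
    (henergy : (fun N : ℕ => (approxEnergy x N 1 : ℝ)) =O[atTop]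
      (fun N : ℕ => (N : ℝ) ^ ((5 : ℝ) / 2 - δ))) :
    MetricPoissonian x := by
  -- Decreasing `δ` only weakens the energy bound, so it may be assumed at most `1/4`.
  have hδ' : 0 < min δ (1 / 4) := lt_min hδ (by norm_num)
  obtain ⟨C₁, hC₁, hb⟩ := henergy.exists_nonneg
  have hE : ∀ᶠ N : ℕ in atTop, (approxEnergy x N 1 : ℝ) ≤
      C₁ * (N : ℝ) ^ ((5 : ℝ) / 2 - min δ (1 / 4)) := by
    filter_upwards [hb.bound, eventually_ge_atTop 1] with N h hN
    have hN1 : (1 : ℝ) ≤ N := by exact_mod_cast hN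
    rw [Real.norm_of_nonneg (by positivity), Real.norm_of_nonneg (by positivity)] at h
    refine h.trans (mul_le_mul_of_nonneg_left ?_ hC₁)
    apply Real.rpow_le_rpow_of_exponent_le hN1
    linarith [min_le_left δ (1 / 4)]
  obtain ⟨p, hp⟩ := exists_nat_ge (4 / min δ (1 / 4))
  rw [div_le_iff₀ hδ'] at hp
  have hp0 : p ≠ 0 := by rintro rfl; norm_num at hp
  -- Restricting to rational parameters leaves a countable union of null sets.
  have hall : ∀ᵐ t : ℝ, ∀ q : ℚ, 0 < q →
      Tendsto (fun k : ℕ => hatSum (fun n => t * x n) q ((k + 1) ^ p)) atTop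
        (nhds ((q : ℝ) ^ 2)) := by
    rw [ae_all_iff]
    intro q
    by_cases hq : 0 < q
    · filter_upwards [ae_tendsto_hatSum hc hgap hδ' (min_le_right _ _) hC₁ hE hp
        (s := (q : ℝ)) (by exact_mod_cast hq)] with t ht _
      exact ht
    · exact ae_of_all _ fun t h => absurd h hq
  filter_upwards [hall] with t ht
  exact hasPoissonianPairCorrelation_of_hatSum hp0 ht
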